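/- Theorem (Efficient influence function). Let $O=(X,A,W,Y)$ be an observation with $X,W$ taking values in arbitrary measurable spaces, exposure $A\in\{0,1\}$ and real outcome $Y$. For a law $P$ of $O$ put $$Q(a,w,x)=\mathbb E_P(Y\mid A=a,W=w,X=x),\quad g(w,x)=P(A=1\mid W=w,X=x),\quad \Delta(w,x)=Q(1,w,x)-Q(0,w,x),\quad \psi(P)=\mathbb E_P\{\Delta(W,X)\}.$$ The nonparametric model consists of all laws $P$ of $O$ with positivity, $0<g(W,X)<1$ $P$-almost surely, for which $Y$ and $\Delta(W,X)$ are $P$-integrable. Write $$h_1=\frac{\mathbf 1\{A=1\}}{g(W,X)}\{Y-Q(1,W,X)\},\qquad h_0=\frac{\mathbf 1\{A=0\}}{1-g(W,X)}\{Y-Q(0,W,X)\},$$ $$\varphi_\psi(O)=h_1-h_0+\Delta(W,X)-\psi(P).$$ A regular submodel through $P$ with score $S\in L_2(P)$ is a family of laws $(P_\varepsilon)_{\varepsilon\in\mathbb R}$ with $P_0=P$ such that: (i) for all $\varepsilon$ near $0$, $P_\varepsilon$ lies in the nonparametric model and $P_\varepsilon\ll P$; (ii) with $p_\varepsilon=dP_\varepsilon/dP$,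 $\big\|\varepsilon^{-1}(\sqrt{p_\varepsilon}-1)-S/2\big\|_{L_2(P)}\to0$ as $\varepsilon\to0$, $\varepsilon\neq 0$; (iii) there is $c>0$ such that for all $\varepsilon$ near $0$, with $g_\varepsilon(w,x)=P_\varepsilon(A=1\mid W=w,X=x)$, one has $g_\varepsilon(W,X)\ge c\,g(W,X)$ and $1-g_\varepsilon(W,X)\ge c\,\{1-g(W,X)\}$ $P_\varepsilon$-almost surely; (iv) the second moments of $h_1$, $h_0$ and $\Delta(W,X)$ (formed from $P$) under $P_\varepsilon$ are bounded uniformly over $\varepsilon$ near $0$. An efficient influence function of $\psi$ at $P$ is a function $\varphi\in L_2(P)$ with $\mathbb E_P\varphi=0$ such that (a) for every regular submodel through $P$ with score $S$, the map $\varepsilon\mapsto\psi(P_\varepsilon)$ is differentiable at $0$ with derivative $\mathbb E_P\{\varphi(O)S(O)\}$; and (b) $\varphi$ belongs to the tangent space, the closed linear span in $L_2(P)$ of the scores of all regular submodels through $P$. Let $P$ belong to the nonparametric model and suppose that $\varphi_\psi\in L_2(P)$. Then $\varphi_\psi$ is an efficient influence function of $\psi$ at $P$, and every efficient influence function of $\psi$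 at $P$ equals $\varphi_\psi$ $P$-almost surely. -/

import Mathlib

open MeasureTheory ProbabilityTheory Filter Topology
open scoped ENNReal

noncomputable section

namespace DirectEffect

/-! ### Influence functions relative to a class of one-dimensional submodels -/

section Generic

variable {Ω : Type*} [MeasurableSpace Ω]

/-- The path `ε ↦ Pt ε` of laws passes through `P` at `ε = 0`, is dominated by `P` near `ε = 0`,
and is differentiable in quadratic mean at `ε = 0` with score `S ∈ L₂(P)`:
`‖(√(dPt ε / dP) - 1) / ε - S / 2‖_{L₂(P)} → 0` as `ε → 0`, `ε ≠ 0`. -/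
structure IsQMDPath (P : ProbabilityMeasure Ω) (Pt : ℝ → ProbabilityMeasure Ω) (S : Ω → ℝ) :
    Prop where
  through : Pt 0 = P
  dominated : ∀ᶠ ε in 𝓝 (0 : ℝ), (Pt ε : Measure Ω) ≪ (P : Measure Ω)
  score_memLp : MemLp S 2 (P : Measure Ω)
  qmd : Tendsto
    (fun ε : ℝ => eLpNorm
      (fun o => (√(((Pt ε : Measure Ω).rnDeriv (P : Measure Ω) o).toReal) - 1) / ε - S o / 2)
      2 (P : Measure Ω))
    (𝓝[≠] 0) (𝓝 0)

/-- The tangent space at `P` of a class `𝒮` of submodels (`𝒮 Pt S` means: `Pt` is an admissible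
submodel through `P` with score `S`): the closed linear span in `L₂(P)` of all scores. -/
def tangentSpace (P : ProbabilityMeasure Ω)
    (𝒮 : (ℝ → ProbabilityMeasure Ω) → (Ω → ℝ) → Prop) :
    Submodule ℝ (Lp ℝ 2 (P : Measure Ω)) :=
  (Submodule.span ℝ
    {s : Lp ℝ 2 (P : Measure Ω) | ∃ Pt : ℝ → ProbabilityMeasure Ω, 𝒮 Pt s}).topologicalClosure

/-- `φ` is an influence function (gradient) at `P` of the functional `θ` along the class `𝒮`:
`φ ∈ L₂(P)` has mean zero, and for each admissible submodel with score `S`,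
`ε ↦ θ (Pt ε)` is differentiable at `0` with derivative `E_P[φ S]`. -/
structure IsInfluenceFunction (P : ProbabilityMeasure Ω)
    (𝒮 : (ℝ → ProbabilityMeasure Ω) → (Ω → ℝ) → Prop)
    (θ : ProbabilityMeasure Ω → ℝ) (φ : Ω → ℝ) : Prop where
  memLp : MemLp φ 2 (P : Measure Ω)
  mean_zero : ∫ o, φ o ∂(P : Measure Ω) = 0
  hasDerivAt : ∀ (Pt : ℝ → ProbabilityMeasure Ω) (S : Ω → ℝ), 𝒮 Pt S →
    HasDerivAt (fun ε : ℝ => θ (Pt ε)) (∫ o, φ o * S o ∂(P : Measure Ω)) 0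

/-- The efficient influence function (canonical gradient): an influence function lying in the
tangent space. -/
structure IsEfficientInfluenceFunction (P : ProbabilityMeasure Ω)
    (𝒮 : (ℝ → ProbabilityMeasure Ω) → (Ω → ℝ) → Prop)
    (θ : ProbabilityMeasure Ω → ℝ) (φ : Ω → ℝ) : Prop
    extends IsInfluenceFunction P 𝒮 θ φ where
  mem_tangentSpace : memLp.toLp φ ∈ tangentSpace P 𝒮

end Generic

/-! ### The observed data and the parameter -/

variable {𝒳 𝒲 : Type*} [MeasurableSpace 𝒳] [MeasurableSpace 𝒲]

/-- Sample space of `O = (X, A, W, Y)`; the exposure `A ∈ {0, 1}` is a Boolean (`true` is `1`). -/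
abbrev Obs (𝒳 𝒲 : Type*) : Type _ := 𝒳 × Bool × 𝒲 × ℝ

def obsX (o : Obs 𝒳 𝒲) : 𝒳 := o.1
def obsA (o : Obs 𝒳 𝒲) : Bool := o.2.1
def obsW (o : Obs 𝒳 𝒲) : 𝒲 := o.2.2.1
def obsY (o : Obs 𝒳 𝒲) : ℝ := o.2.2.2

/-- `Q(a, w, x) = E_P(Y | A = a, W = w, X = x)`: the mean of the regular conditional distribution
of `Y` given `(A, W, X) = (a, w, x)`. -/
def outcomeReg (P : ProbabilityMeasure (Obs 𝒳 𝒲)) (a : Bool) (w : 𝒲) (x : 𝒳) : ℝ :=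
  ∫ y, y ∂(condDistrib (obsY : Obs 𝒳 𝒲 → ℝ) (fun o => (obsA o, obsW o, obsX o))
    (P : Measure (Obs 𝒳 𝒲)) (a, w, x))

/-- `g(w, x) = P(A = 1 | W = w, X = x)`. -/
def propensity (P : ProbabilityMeasure (Obs 𝒳 𝒲)) (w : 𝒲) (x : 𝒳) : ℝ :=
  (condDistrib (obsA : Obs 𝒳 𝒲 → Bool) (fun o => (obsW o, obsX o))
    (P : Measure (Obs 𝒳 𝒲)) (w, x)).real {true}

/-- `Δ(w, x) = Q(1, w, x) - Q(0, w, x)`. -/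
def contrast (P : ProbabilityMeasure (Obs 𝒳 𝒲)) (w : 𝒲) (x : 𝒳) : ℝ :=
  outcomeReg P true w x - outcomeReg P false w x

/-- `ψ(P) = E_P{Δ(W, X)}`. -/
def psi (P : ProbabilityMeasure (Obs 𝒳 𝒲)) : ℝ :=
  ∫ o, contrast P (obsW o) (obsX o) ∂(P : Measure (Obs 𝒳 𝒲))

/-- `0 < P(A = 1 | W, X) < 1` almost surely. -/
def Positivity (P : ProbabilityMeasure (Obs 𝒳 𝒲)) : Prop :=
  ∀ᵐ o ∂(P : Measure (Obs 𝒳 𝒲)),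
    0 < propensity P (obsW o) (obsX o) ∧ propensity P (obsW o) (obsX o) < 1

/-- The nonparametric model: all laws of `O` satisfying positivity for which `ψ` is well defined,
that is, `Y` and `Δ(W, X)` are integrable. -/
structure InModel (P : ProbabilityMeasure (Obs 𝒳 𝒲)) : Prop where
  positivity : Positivity P
  integrable_outcome : Integrable (obsY : Obs 𝒳 𝒲 → ℝ) (P : Measure (Obs 𝒳 𝒲))
  integrable_contrast :
    Integrable (fun o => contrast P (obsW o) (obsX o)) (P : Measure (Obs 𝒳 𝒲))

/-- `1{A = 1} / g(W, X) * {Y - Q(1, W, X)}`. -/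
def treatedResidual (P : ProbabilityMeasure (Obs 𝒳 𝒲)) (o : Obs 𝒳 𝒲) : ℝ :=
  (if obsA o = true then 1 else 0) / propensity P (obsW o) (obsX o)
    * (obsY o - outcomeReg P true (obsW o) (obsX o))

/-- `1{A = 0} / (1 - g(W, X)) * {Y - Q(0, W, X)}`. -/
def controlResidual (P : ProbabilityMeasure (Obs 𝒳 𝒲)) (o : Obs 𝒳 𝒲) : ℝ :=
  (if obsA o = false then 1 else 0) / (1 - propensity P (obsW o) (obsX o))
    * (obsY o - outcomeReg P false (obsW o) (obsX o))

/-- The augmented inverse-probability-weighted function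
`1{A=1}/g {Y - Q(1,W,X)} - 1{A=0}/(1-g) {Y - Q(0,W,X)} + Δ(W,X) - ψ(P)`. -/
def aipw (P : ProbabilityMeasure (Obs 𝒳 𝒲)) (o : Obs 𝒳 𝒲) : ℝ :=
  treatedResidual P o - controlResidual P o + contrast P (obsW o) (obsX o) - psi P

/-- Regular one-dimensional parametric submodels of the nonparametric model through `P`, with
score `S`: paths inside the model that are differentiable in quadratic mean, along which
positivity does not degenerate relative to `P` and the second moments of the weighted residuals
and of the contrast stay bounded, locally uniformly near `ε = 0`. At `ε = 0` the two local
conditions say no more than that the candidate function is square integrable. -/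
structure IsRegularSubmodel (P : ProbabilityMeasure (Obs 𝒳 𝒲))
    (Pt : ℝ → ProbabilityMeasure (Obs 𝒳 𝒲)) (S : Obs 𝒳 𝒲 → ℝ) : Prop
    extends IsQMDPath P Pt S where
  inModel : ∀ᶠ ε in 𝓝 (0 : ℝ), InModel (Pt ε)
  positivity_locally : ∃ c : ℝ, 0 < c ∧ ∀ᶠ ε in 𝓝 (0 : ℝ),
    ∀ᵐ o ∂(Pt ε : Measure (Obs 𝒳 𝒲)),
      c * propensity P (obsW o) (obsX o) ≤ propensity (Pt ε) (obsW o) (obsX o) ∧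
      c * (1 - propensity P (obsW o) (obsX o)) ≤ 1 - propensity (Pt ε) (obsW o) (obsX o)
  moments_locally : ∃ C : ℝ≥0∞, C ≠ ∞ ∧ ∀ᶠ ε in 𝓝 (0 : ℝ),
    eLpNorm (treatedResidual P) 2 (Pt ε : Measure (Obs 𝒳 𝒲)) ≤ C ∧
    eLpNorm (controlResidual P) 2 (Pt ε : Measure (Obs 𝒳 𝒲)) ≤ C ∧
    eLpNorm (fun o => contrast P (obsW o) (obsX o)) 2 (Pt ε : Measure (Obs 𝒳 𝒲)) ≤ C

end DirectEffect

end

/-! Write V = (W, X), π_a(V) = P(A = a | V) and h_a for the weighted residual of arm a. Inverse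
probability weighting under another law P' of the model (`integral_ipw`) gives the exact expansion
`psi_expansion`: ψ(P') = E'[h_1 - h_0 + Δ] plus remainders ± E'[m_a h_a], where Δ and h_a are formed
from P and m_a = (π_a - π'_a) / π'_a is a function of V, bounded thanks to the positivity condition.

Pathwise derivative. With r the square root of dP_ε/dP, a difference of means is ∫ f (r - 1)(r + 1)
dP, so quadratic mean differentiability makes the mean of a fixed f with locally bounded second
moments differentiable with derivative E[f S] (`IsQMDPath.hasDerivAt_integral`). This handles the
leading term. The remainder is o(ε): h_a is orthogonal under P to every function of V for which the
product is integrable, hence E[m_a h_a] = 0, and the difference quotient of E_ε[m_a h_a] is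
controlled by ‖m_a S‖ and the vanishing quadratic mean remainder
(`IsQMDPath.hasDerivAt_integral_mul_zero`). That ‖m_a S‖ → 0 follows from the Hellinger continuity
of the treatment probabilities (`tendsto_relProbError_mul`). No rate for the outcome regressions is
needed.

Tangent space. Tilting P by the density 1 + ε S with S bounded by one and of mean zero gives laws
comparable to P up to the factor 2, and such tilts are regular submodels (`isRegularSubmodel_tilt`).
Taking S = 1_B - P(B) for all measurable B shows that only constants are orthogonal to all scores
(`ae_eq_const_of_orthogonal`). Hence every mean zero element of L₂(P) is in the tangent space, and
two influence functions, whose difference is orthogonal to all scores and has mean zero, coincide.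
-/

namespace DirectEffect


/-! ### Conditional means, inverse probability weighting and the weighted residuals -/

section Conditional

variable {𝒳 𝒲 : Type*}

/-- The indicator of `{A = a}`. -/
noncomputable def armInd (a : Bool) (o : Obs 𝒳 𝒲) : ℝ := if obsA o = a then 1 else 0

lemma armInd_nonneg (a : Bool) (o : Obs 𝒳 𝒲) : 0 ≤ armInd a o := by
  unfold armInd; split_ifs <;> norm_num

lemma armInd_le_one (a : Bool) (o : Obs 𝒳 𝒲) : armInd a o ≤ 1 := by
  unfold armInd; split_ifs <;> norm_num

variable [MeasurableSpace 𝒳] [MeasurableSpace 𝒲]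

/-- The covariates `V = (W, X)`. -/
def covar (o : Obs 𝒳 𝒲) : 𝒲 × 𝒳 := (obsW o, obsX o)

/-- The regressors `(A, W, X)`. -/
def regressors (o : Obs 𝒳 𝒲) : Bool × 𝒲 × 𝒳 := (obsA o, obsW o, obsX o)

/-- `P(A = a | V = v)`. -/
noncomputable def armProb (P : ProbabilityMeasure (Obs 𝒳 𝒲)) (a : Bool) (v : 𝒲 × 𝒳) : ℝ :=
  if a then propensity P v.1 v.2 else 1 - propensity P v.1 v.2

/-- `E_P(Y | A = a, V = v)`. -/
noncomputable def armMean (P : ProbabilityMeasure (Obs 𝒳 𝒲)) (a : Bool) (v : 𝒲 × 𝒳) : ℝ :=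
  outcomeReg P a v.1 v.2

/-- The weighted residual `1{A = a} / P(A = a | V) * (Y - E_P(Y | A = a, V))`. -/
noncomputable def armResidual (P : ProbabilityMeasure (Obs 𝒳 𝒲)) (a : Bool) (o : Obs 𝒳 𝒲) : ℝ :=
  armInd a o / armProb P a (covar o) * (obsY o - armMean P a (covar o))

lemma armResidual_true (P : ProbabilityMeasure (Obs 𝒳 𝒲)) :
    armResidual P true = treatedResidual P := by
  funext o; simp [armResidual, treatedResidual, armInd, armProb, covar, armMean]

lemma armResidual_false (P : ProbabilityMeasure (Obs 𝒳 𝒲)) :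
    armResidual P false = controlResidual P := by
  funext o; simp [armResidual, controlResidual, armInd, armProb, covar, armMean]

lemma armResidual_eq (P : ProbabilityMeasure (Obs 𝒳 𝒲)) (a : Bool) (o : Obs 𝒳 𝒲) :
    armResidual P a o =
      (armProb P a (covar o))⁻¹ * (armInd a o * (obsY o - armMean P a (covar o))) := by
  rw [armResidual]; ring

lemma measurable_obsX : Measurable (obsX : Obs 𝒳 𝒲 → 𝒳) := measurable_fst

lemma measurable_obsA : Measurable (obsA : Obs 𝒳 𝒲 → Bool) := measurable_fst.comp measurable_snd

lemma measurable_obsW : Measurable (obsW : Obs 𝒳 𝒲 → 𝒲) :=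
  measurable_fst.comp (measurable_snd.comp measurable_snd)

lemma measurable_obsY : Measurable (obsY : Obs 𝒳 𝒲 → ℝ) :=
  measurable_snd.comp (measurable_snd.comp measurable_snd)

lemma measurable_covar : Measurable (covar : Obs 𝒳 𝒲 → 𝒲 × 𝒳) :=
  measurable_obsW.prodMk measurable_obsX

lemma measurable_regressors : Measurable (regressors : Obs 𝒳 𝒲 → Bool × 𝒲 × 𝒳) :=
  measurable_obsA.prodMk measurable_covar

lemma measurable_armInd (a : Bool) : Measurable (armInd a : Obs 𝒳 𝒲 → ℝ) :=
  (measurable_of_countable (fun b : Bool => if b = a then (1 : ℝ) else 0)).comp measurable_obsA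

variable (P : ProbabilityMeasure (Obs 𝒳 𝒲))

lemma measurable_armProb (a : Bool) : Measurable (armProb P a) := by
  have h : Measurable (fun v : 𝒲 × 𝒳 => propensity P v.1 v.2) :=
    (Kernel.measurable_coe (condDistrib (obsA : Obs 𝒳 𝒲 → Bool) (fun o => (obsW o, obsX o))
      (P : Measure (Obs 𝒳 𝒲))) (MeasurableSet.singleton true)).ennreal_toReal
  cases a
  · exact measurable_const.sub h
  · exact h

lemma armProb_nonneg (a : Bool) (v : 𝒲 × 𝒳) : 0 ≤ armProb P a v := by
  cases a
  · simp [armProb, propensity]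
  · simp [armProb, propensity]

lemma armProb_le_one (a : Bool) (v : 𝒲 × 𝒳) : armProb P a v ≤ 1 := by
  cases a
  · simp [armProb, propensity]
  · simp [armProb, propensity]

lemma measurable_armMean (a : Bool) : Measurable (armMean P a) := by
  have h : StronglyMeasurable (fun z : Bool × 𝒲 × 𝒳 =>
      ∫ y, y ∂(condDistrib (obsY : Obs 𝒳 𝒲 → ℝ) (fun o => (obsA o, obsW o, obsX o))
        (P : Measure (Obs 𝒳 𝒲)) z)) :=
    StronglyMeasurable.integral_condDistrib (f := fun p : (Bool × 𝒲 × 𝒳) × ℝ => p.2)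
      measurable_snd.stronglyMeasurable
  exact h.measurable.comp (measurable_const.prodMk measurable_id)

lemma measurable_armResidual (a : Bool) : Measurable (armResidual P a) :=
  ((measurable_armInd a).div ((measurable_armProb P a).comp measurable_covar)).mul
    (measurable_obsY.sub ((measurable_armMean P a).comp measurable_covar))

variable {P}

lemma Positivity.armProb_pos (h : Positivity P) (a : Bool) :
    ∀ᵐ o ∂(P : Measure (Obs 𝒳 𝒲)), 0 < armProb P a (covar o) := by
  filter_upwards [h] with o ho
  cases a
  · simpa [armProb, covar] using ho.2
  · simpa [armProb, covar] using ho.1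

lemma integrable_armInd (a : Bool) : Integrable (armInd a) (P : Measure (Obs 𝒳 𝒲)) :=
  Integrable.of_bound (measurable_armInd a).aestronglyMeasurable 1 <| ae_of_all _ fun o => by
    rw [Real.norm_of_nonneg (armInd_nonneg a o)]; exact armInd_le_one a o

lemma condExp_armInd (a : Bool) :
    (P : Measure (Obs 𝒳 𝒲))[armInd a | MeasurableSpace.comap covar inferInstance]
      =ᵐ[(P : Measure (Obs 𝒳 𝒲))] fun o => armProb P a (covar o) := by
  have h := condDistrib_ae_eq_condExp (μ := (P : Measure (Obs 𝒳 𝒲))) measurable_covar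
    measurable_obsA (MeasurableSet.singleton a)
  have h1 : (obsA ⁻¹' {a}).indicator (fun _ => (1 : ℝ)) = (armInd a : Obs 𝒳 𝒲 → ℝ) := by
    funext o
    by_cases ho : obsA o = a <;> simp [Set.indicator, armInd, ho]
  rw [h1] at h
  refine h.symm.trans (ae_of_all _ fun o => ?_)
  cases a
  · have := measureReal_compl (μ := condDistrib (obsA : Obs 𝒳 𝒲 → Bool) covar
      (P : Measure (Obs 𝒳 𝒲)) (covar o)) (MeasurableSet.singleton true)
    have h2 : ({true} : Set Bool)ᶜ = {false} := by ext b; cases b <;> simp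
    rw [h2, probReal_univ] at this
    exact this
  · rfl

/-- Condition on V and pull f(V) out. Integrability on the left is inherited from the conditional
expectation, so no bound on f is needed. -/
lemma integrable_mul_armProb {f : 𝒲 × 𝒳 → ℝ} (hf : Measurable f) {a : Bool}
    (hi : Integrable (fun o => f (covar o) * armInd a o) (P : Measure (Obs 𝒳 𝒲))) :
    Integrable (fun o => f (covar o) * armProb P a (covar o)) (P : Measure (Obs 𝒳 𝒲)) ∧
      ∫ o, f (covar o) * armProb P a (covar o) ∂(P : Measure (Obs 𝒳 𝒲)) =
        ∫ o, f (covar o) * armInd a o ∂(P : Measure (Obs 𝒳 𝒲)) := by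
  have hm := (measurable_covar (𝒳 := 𝒳) (𝒲 := 𝒲)).comap_le
  have h := condExp_mul_of_stronglyMeasurable_left (μ := (P : Measure (Obs 𝒳 𝒲)))
    (m := MeasurableSpace.comap covar inferInstance) (f := fun o => f (covar o)) (g := armInd a)
    (hf.comp (comap_measurable covar)).stronglyMeasurable hi (integrable_armInd a)
  have h' : (P : Measure (Obs 𝒳 𝒲))[fun o => f (covar o) * armInd a o |
      MeasurableSpace.comap covar inferInstance] =ᵐ[(P : Measure (Obs 𝒳 𝒲))]
      fun o => f (covar o) * armProb P a (covar o) := by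
    refine h.trans ?_
    filter_upwards [condExp_armInd (P := P) a] with o ho
    simp [ho]
  exact ⟨integrable_condExp.congr h', by rw [← integral_congr_ae h', integral_condExp hm]⟩

lemma armInd_mul_regression (a : Bool) (o : Obs 𝒳 𝒲) :
    armInd a o * outcomeReg P (obsA o) (obsW o) (obsX o) = armInd a o * armMean P a (covar o) := by
  unfold armInd armMean covar
  split_ifs with h
  · rw [h]
  · simp

lemma condExp_outcome (hY : Integrable obsY (P : Measure (Obs 𝒳 𝒲))) :
    (P : Measure (Obs 𝒳 𝒲))[obsY | MeasurableSpace.comap regressors inferInstance]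
      =ᵐ[(P : Measure (Obs 𝒳 𝒲))] fun o => outcomeReg P (obsA o) (obsW o) (obsX o) :=
  condExp_ae_eq_integral_condDistrib' measurable_regressors hY

lemma integrable_armInd_mul {f : Obs 𝒳 𝒲 → ℝ} (hf : Integrable f (P : Measure (Obs 𝒳 𝒲)))
    (a : Bool) : Integrable (fun o => armInd a o * f o) (P : Measure (Obs 𝒳 𝒲)) :=
  hf.bdd_mul (c := 1) (measurable_armInd a).aestronglyMeasurable <| ae_of_all _ fun o => by
    rw [Real.norm_of_nonneg (armInd_nonneg a o)]; exact armInd_le_one a o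

lemma integrable_armInd_mul_armMean (hY : Integrable obsY (P : Measure (Obs 𝒳 𝒲))) (a : Bool) :
    Integrable (fun o => armInd a o * armMean P a (covar o)) (P : Measure (Obs 𝒳 𝒲)) := by
  simp_rw [← armInd_mul_regression]
  exact integrable_armInd_mul (integrable_condExp.congr (condExp_outcome hY)) a

/-- Conditioning a weighted residual of the arm `a` on `(A, W, X)`. -/
lemma condExp_weighted_residual (hY : Integrable obsY (P : Measure (Obs 𝒳 𝒲)))
    {k F : 𝒲 × 𝒳 → ℝ} (hk : Measurable k) (hF : Measurable F) {a : Bool}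
    (hi : Integrable (fun o => armInd a o * (obsY o - F (covar o))) (P : Measure (Obs 𝒳 𝒲)))
    (hki : Integrable (fun o => k (covar o) * (armInd a o * (obsY o - F (covar o))))
      (P : Measure (Obs 𝒳 𝒲))) :
    (P : Measure (Obs 𝒳 𝒲))[fun o => k (covar o) * (armInd a o * (obsY o - F (covar o))) |
        MeasurableSpace.comap regressors inferInstance] =ᵐ[(P : Measure (Obs 𝒳 𝒲))]
      fun o => k (covar o) * (armMean P a (covar o) - F (covar o)) * armInd a o := by
  have hAY := integrable_armInd_mul hY a
  have hcE := condExp_outcome hY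
  have hreg' := fun o => armInd_mul_regression (P := P) a o
  set μ := (P : Measure (Obs 𝒳 𝒲)) with hμ
  have : IsProbabilityMeasure μ := by rw [hμ]; infer_instance
  set m : MeasurableSpace (Obs 𝒳 𝒲) := MeasurableSpace.comap regressors inferInstance with hmdef
  have hm := (measurable_regressors (𝒳 := 𝒳) (𝒲 := 𝒲)).comap_le
  have hreg : Measurable[m] (regressors : Obs 𝒳 𝒲 → _) := comap_measurable regressors
  have hcov : Measurable[m] (covar : Obs 𝒳 𝒲 → _) := measurable_snd.comp hreg
  have hA : Measurable[m] (obsA : Obs 𝒳 𝒲 → _) :=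
    (measurable_fst (α := Bool) (β := 𝒲 × 𝒳)).comp hreg
  have hind : Measurable[m] (armInd a : Obs 𝒳 𝒲 → ℝ) :=
    (measurable_of_countable (fun b : Bool => if b = a then (1 : ℝ) else 0)).comp hA
  have h1 := condExp_mul_of_stronglyMeasurable_left (μ := μ) (m := m)
    (f := fun o => k (covar o)) (g := fun o => armInd a o * (obsY o - F (covar o)))
    (hk.comp hcov).stronglyMeasurable hki hi
  have hAF : Integrable (fun o => armInd a o * F (covar o)) μ := by
    refine (hAY.sub hi).congr (ae_of_all _ fun o => ?_)
    simp only [Pi.sub_apply]; ring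
  have h2 := condExp_mul_of_stronglyMeasurable_left (μ := μ) (m := m)
    (f := armInd a) (g := obsY) hind.stronglyMeasurable hAY hY
  have h3 := condExp_of_stronglyMeasurable (μ := μ) hm
    (f := fun o => armInd a o * F (covar o))
    (hind.mul (hF.comp hcov)).stronglyMeasurable hAF
  have h4 := condExp_sub (m := m) hAY hAF
  have h5 : (fun o => armInd a o * (obsY o - F (covar o))) =
      (fun o => armInd a o * obsY o) - fun o : Obs 𝒳 𝒲 => armInd a o * F (covar o) := by
    funext o; simp only [Pi.sub_apply]; ring
  refine h1.trans ?_
  rw [h5]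
  filter_upwards [h4, h2, hcE] with o ho4 ho2 hoY
  rw [Pi.mul_apply, ho4, Pi.sub_apply, h3]
  erw [ho2]
  rw [Pi.mul_apply, hoY, hreg']
  ring

/-- Tower property in two stages: conditioning on (A, V) replaces Y by its regression, then
conditioning on V replaces the arm indicator by its probability. -/
lemma integrable_weighted_residual (hY : Integrable obsY (P : Measure (Obs 𝒳 𝒲)))
    {k F : 𝒲 × 𝒳 → ℝ} (hk : Measurable k) (hF : Measurable F) {a : Bool}
    (hi : Integrable (fun o => armInd a o * (obsY o - F (covar o))) (P : Measure (Obs 𝒳 𝒲)))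
    (hki : Integrable (fun o => k (covar o) * (armInd a o * (obsY o - F (covar o))))
      (P : Measure (Obs 𝒳 𝒲))) :
    Integrable (fun o => k (covar o) * (armMean P a (covar o) - F (covar o)) *
        armProb P a (covar o)) (P : Measure (Obs 𝒳 𝒲)) ∧
      ∫ o, k (covar o) * (armMean P a (covar o) - F (covar o)) * armProb P a (covar o)
          ∂(P : Measure (Obs 𝒳 𝒲)) =
        ∫ o, k (covar o) * (armInd a o * (obsY o - F (covar o))) ∂(P : Measure (Obs 𝒳 𝒲)) := by
  have h := condExp_weighted_residual hY hk hF hi hki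
  have h1 := integrable_mul_armProb (P := P) (a := a)
    (f := fun v => k v * (armMean P a v - F v))
    (hk.mul ((measurable_armMean P a).sub hF)) (integrable_condExp.congr h)
  refine ⟨h1.1, h1.2.trans ?_⟩
  rw [← integral_congr_ae h, integral_condExp measurable_regressors.comap_le]

/-- The inverse probability weighted mean of `Y - F` in arm `a` is the mean of the regression
error of `F`. -/
lemma integral_ipw (hY : Integrable obsY (P : Measure (Obs 𝒳 𝒲))) (hpos : Positivity P)
    {F : 𝒲 × 𝒳 → ℝ} (hF : Measurable F) {a : Bool}
    (hi : Integrable (fun o => (armProb P a (covar o))⁻¹ *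
      (armInd a o * (obsY o - F (covar o)))) (P : Measure (Obs 𝒳 𝒲))) :
    Integrable (fun o => armMean P a (covar o) - F (covar o)) (P : Measure (Obs 𝒳 𝒲)) ∧
      ∫ o, (armMean P a (covar o) - F (covar o)) ∂(P : Measure (Obs 𝒳 𝒲)) =
        ∫ o, (armProb P a (covar o))⁻¹ * (armInd a o * (obsY o - F (covar o)))
          ∂(P : Measure (Obs 𝒳 𝒲)) := by
  have hi' : Integrable (fun o => armInd a o * (obsY o - F (covar o)))
      (P : Measure (Obs 𝒳 𝒲)) := by
    -- Multiplying by the arm probability, which is at most one, removes the weight.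
    have hb := hi.bdd_mul (c := 1) (f := fun o => armProb P a (covar o))
      ((measurable_armProb P a).comp measurable_covar).aestronglyMeasurable
      (ae_of_all _ fun o => by
        rw [Real.norm_of_nonneg (armProb_nonneg P a _)]; exact armProb_le_one P a _)
    refine hb.congr ?_
    filter_upwards [hpos.armProb_pos a] with o ho
    field_simp
  have h := integrable_weighted_residual hY (measurable_armProb P a).inv hF hi' hi
  have h1 : (fun o => (armProb P a)⁻¹ (covar o) * (armMean P a (covar o) - F (covar o)) *
      armProb P a (covar o)) =ᵐ[(P : Measure (Obs 𝒳 𝒲))]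
      fun o => armMean P a (covar o) - F (covar o) := by
    filter_upwards [hpos.armProb_pos a] with o ho
    simp only [Pi.inv_apply]
    field_simp
  exact ⟨h.1.congr h1, by rw [← integral_congr_ae h1]; exact h.2⟩

lemma integrable_armInd_mul_sub_armMean (hY : Integrable obsY (P : Measure (Obs 𝒳 𝒲)))
    (a : Bool) :
    Integrable (fun o => armInd a o * (obsY o - armMean P a (covar o)))
      (P : Measure (Obs 𝒳 𝒲)) := by
  refine ((integrable_armInd_mul hY a).sub (integrable_armInd_mul_armMean hY a)).congr
    (ae_of_all _ fun o => ?_)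
  simp only [Pi.sub_apply]; ring

/-- The preceding conditioning with F the true regression, so that the regression error vanishes.
This orthogonality is what makes the remainder of the expansion of ψ second order. -/
lemma integral_mul_armResidual (hY : Integrable obsY (P : Measure (Obs 𝒳 𝒲)))
    {k : 𝒲 × 𝒳 → ℝ} (hk : Measurable k) {a : Bool}
    (hi : Integrable (fun o => k (covar o) * armResidual P a o) (P : Measure (Obs 𝒳 𝒲))) :
    ∫ o, k (covar o) * armResidual P a o ∂(P : Measure (Obs 𝒳 𝒲)) = 0 := by
  have he : (fun o => k (covar o) * armResidual P a o) = fun o : Obs 𝒳 𝒲 =>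
      (k (covar o) * (armProb P a (covar o))⁻¹) *
        (armInd a o * (obsY o - armMean P a (covar o))) := by
    funext o; rw [armResidual_eq]; ring
  rw [he] at hi ⊢
  rw [← (integrable_weighted_residual (k := fun v => k v * (armProb P a v)⁻¹) hY
    (hk.mul (measurable_armProb P a).inv) (measurable_armMean P a)
    (integrable_armInd_mul_sub_armMean hY a) hi).2]
  simp

lemma condExp_armResidual (hY : Integrable obsY (P : Measure (Obs 𝒳 𝒲))) {a : Bool}
    (hi : Integrable (armResidual P a) (P : Measure (Obs 𝒳 𝒲))) :
    (P : Measure (Obs 𝒳 𝒲))[armResidual P a | MeasurableSpace.comap regressors inferInstance]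
      =ᵐ[(P : Measure (Obs 𝒳 𝒲))] 0 := by
  have he : armResidual P a = fun o => (fun v => (armProb P a v)⁻¹) (covar o) *
      (armInd a o * (obsY o - armMean P a (covar o))) := by
    funext o; rw [armResidual_eq]
  have h := condExp_weighted_residual (k := fun v => (armProb P a v)⁻¹) hY
    (measurable_armProb P a).inv (measurable_armMean P a)
    (integrable_armInd_mul_sub_armMean hY a) (by rw [← he]; exact hi)
  rw [← he] at h
  exact h.trans (ae_of_all _ fun o => by simp)

lemma measurable_contrast :
    Measurable (fun o : Obs 𝒳 𝒲 => contrast P (obsW o) (obsX o)) :=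
  ((measurable_armMean P true).comp measurable_covar).sub
    ((measurable_armMean P false).comp measurable_covar)

lemma armInd_mul_armResidual (a b : Bool) (o : Obs 𝒳 𝒲) :
    armInd a o * armResidual P b o = if a = b then armResidual P b o else 0 := by
  unfold armResidual armInd
  cases a <;> cases b <;> cases obsA o <;> simp

/-- Square integrability of the augmented inverse probability weighted function passes to each of
its three parts. -/
lemma memLp_parts (hP : InModel P) (hvar : MemLp (aipw P) 2 (P : Measure (Obs 𝒳 𝒲))) :
    MemLp (fun o => contrast P (obsW o) (obsX o)) 2 (P : Measure (Obs 𝒳 𝒲)) ∧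
      ∀ a, MemLp (armResidual P a) 2 (P : Measure (Obs 𝒳 𝒲)) := by
  have hm := (measurable_regressors (𝒳 := 𝒳) (𝒲 := 𝒲)).comap_le
  have hval : aipw P = (armResidual P true - armResidual P false) +
      fun o => contrast P (obsW o) (obsX o) - psi P := by
    funext o
    simp only [aipw, armResidual_true, armResidual_false, Pi.add_apply, Pi.sub_apply]
    ring
  have hcI : Integrable (fun o => contrast P (obsW o) (obsX o) - psi P)
      (P : Measure (Obs 𝒳 𝒲)) := hP.integrable_contrast.sub (integrable_const _)
  have hdI : Integrable (armResidual P true - armResidual P false)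
      (P : Measure (Obs 𝒳 𝒲)) := by
    have := (hvar.integrable (by norm_num)).sub hcI
    rwa [hval, add_sub_cancel_right] at this
  have h1I : Integrable (armResidual P true) (P : Measure (Obs 𝒳 𝒲)) := by
    refine (integrable_armInd_mul hdI true).congr (ae_of_all _ fun o => ?_)
    simp [mul_sub, armInd_mul_armResidual]
  have h0I : Integrable (armResidual P false) (P : Measure (Obs 𝒳 𝒲)) := by
    have := h1I.sub hdI
    rwa [sub_sub_cancel] at this
  have hcm : StronglyMeasurable[MeasurableSpace.comap (regressors : Obs 𝒳 𝒲 → _) inferInstance]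
      (fun o : Obs 𝒳 𝒲 => contrast P (obsW o) (obsX o) - psi P) := by
    have hcov : Measurable[MeasurableSpace.comap (regressors : Obs 𝒳 𝒲 → _) inferInstance]
      (covar : Obs 𝒳 𝒲 → _) := measurable_snd.comp (comap_measurable regressors)
    exact ((((measurable_armMean P true).comp hcov).sub
      ((measurable_armMean P false).comp hcov)).sub measurable_const).stronglyMeasurable
  -- Conditioning on (A, V) kills both residuals and leaves Δ - ψ, and conditional expectation
  -- preserves square integrability.
  have hce : (P : Measure (Obs 𝒳 𝒲))[aipw P |
      MeasurableSpace.comap regressors inferInstance] =ᵐ[(P : Measure (Obs 𝒳 𝒲))]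
      fun o => contrast P (obsW o) (obsX o) - psi P := by
    rw [hval]
    refine (condExp_add hdI hcI _).trans ?_
    rw [condExp_of_stronglyMeasurable hm hcm hcI]
    filter_upwards [condExp_sub h1I h0I (MeasurableSpace.comap regressors inferInstance),
      condExp_armResidual hP.integrable_outcome h1I,
      condExp_armResidual hP.integrable_outcome h0I] with o ho h1 h0
    rw [Pi.add_apply, ho, Pi.sub_apply, h1, h0]
    simp
  have hcL : MemLp (fun o => contrast P (obsW o) (obsX o) - psi P) 2
      (P : Measure (Obs 𝒳 𝒲)) := (hvar.condExp (by norm_num)).ae_eq hce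
  have hdL : MemLp (armResidual P true - armResidual P false) 2 (P : Measure (Obs 𝒳 𝒲)) := by
    have := hvar.sub hcL
    rwa [hval, add_sub_cancel_right] at this
  refine ⟨?_, fun a => ?_⟩
  · have := hcL.add (memLp_const (psi P))
    refine this.ae_eq (ae_of_all _ fun o => ?_)
    simp
  -- The two residuals live on disjoint arms, so the indicator of an arm recovers its residual, up
  -- to sign, from their difference.
  · refine hdL.of_le (measurable_armResidual P a).aestronglyMeasurable (ae_of_all _ fun o => ?_)
    have h1 := armInd_mul_armResidual (P := P) a true o
    have h0 := armInd_mul_armResidual (P := P) a false o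
    have hle : ‖armInd a o * (armResidual P true o - armResidual P false o)‖ ≤
        ‖armResidual P true o - armResidual P false o‖ := by
      rw [norm_mul, Real.norm_of_nonneg (armInd_nonneg a o)]
      exact mul_le_of_le_one_left (norm_nonneg _) (armInd_le_one a o)
    rw [mul_sub, h1, h0] at hle
    cases a <;> simpa using hle

end Conditional


/-! ### Differentiability of means along paths differentiable in quadratic mean -/

section QuadraticMean

/-- Used for truncation arguments: the vanishing bound y may depend on the truncation level, hence
on δ, while the constant C may not. -/
lemma tendsto_zero_of_forall_le_add {ι : Type*} {l : Filter ι} {x : ι → ℝ≥0∞} {C : ℝ≥0∞}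
    (hC : C ≠ ∞) (h : ∀ δ : ℝ, 0 < δ → ∃ y : ι → ℝ≥0∞, Tendsto y l (𝓝 0) ∧
      ∀ᶠ i in l, x i ≤ y i + C * ENNReal.ofReal δ) :
    Tendsto x l (𝓝 0) := by
  rw [ENNReal.tendsto_nhds_zero]
  intro η hη
  have h2 : Tendsto (fun δ : ℝ => C * ENNReal.ofReal δ) (𝓝[>] 0) (𝓝 0) := by
    have : Tendsto (fun δ : ℝ => C * ENNReal.ofReal δ) (𝓝 0) (𝓝 (C * ENNReal.ofReal 0)) :=
      ENNReal.Tendsto.const_mul (ENNReal.continuous_ofReal.tendsto 0) (Or.inr hC)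
    rw [ENNReal.ofReal_zero, mul_zero] at this
    exact this.mono_left nhdsWithin_le_nhds
  have hη2 : 0 < η / 2 := ENNReal.half_pos hη.ne'
  obtain ⟨δ, hδ, hδ0⟩ := ((ENNReal.tendsto_nhds_zero.1 h2 (η / 2) hη2).and
    self_mem_nhdsWithin).exists
  obtain ⟨y, hy, hxy⟩ := h δ hδ0
  filter_upwards [hxy, ENNReal.tendsto_nhds_zero.1 hy (η / 2) hη2] with i hi hyi
  calc x i ≤ y i + C * ENNReal.ofReal δ := hi
    _ ≤ η / 2 + η / 2 := add_le_add hyi hδ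
    _ = η := ENNReal.add_halves η

variable {Ω : Type*} [MeasurableSpace Ω]

lemma eLpNorm_two_eq (μ : Measure Ω) (f : Ω → ℝ) :
    eLpNorm f 2 μ = (∫⁻ o, ‖f o‖ₑ ^ 2 ∂μ) ^ (1 / 2 : ℝ) := by
  rw [eLpNorm_eq_lintegral_rpow_enorm_toReal (by norm_num) (by norm_num)]
  simp

lemma enorm_integral_mul_le {μ : Measure Ω} {f g : Ω → ℝ} (hf : AEStronglyMeasurable f μ)
    (hg : AEStronglyMeasurable g μ) :
    ‖∫ o, f o * g o ∂μ‖ₑ ≤ eLpNorm f 2 μ * eLpNorm g 2 μ := by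
  have h := eLpNorm_smul_le_mul_eLpNorm (p := 2) (q := 2) (r := 1) hg hf
  calc ‖∫ o, f o * g o ∂μ‖ₑ ≤ ∫⁻ o, ‖f o * g o‖ₑ ∂μ := enorm_integral_le_lintegral_enorm _
    _ = eLpNorm (f • g) 1 μ := by rw [eLpNorm_one_eq_lintegral_enorm]; rfl
    _ ≤ _ := h

/-- The square root of the density of `P'` relative to `P`. -/
noncomputable def sqrtDensity (P P' : ProbabilityMeasure Ω) (o : Ω) : ℝ :=
  √(((P' : Measure Ω).rnDeriv (P : Measure Ω) o).toReal)

variable {P P' : ProbabilityMeasure Ω}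

lemma measurable_sqrtDensity : Measurable (sqrtDensity P P') :=
  (Measure.measurable_rnDeriv _ _).ennreal_toReal.sqrt

lemma sqrtDensity_mul_self (o : Ω) : sqrtDensity P P' o * sqrtDensity P P' o =
    ((P' : Measure Ω).rnDeriv (P : Measure Ω) o).toReal :=
  Real.mul_self_sqrt ENNReal.toReal_nonneg

lemma eLpNorm_mul_sqrtDensity (hac : (P' : Measure Ω) ≪ (P : Measure Ω)) {f : Ω → ℝ}
    (hf : Measurable f) :
    eLpNorm (fun o => f o * sqrtDensity P P' o) 2 (P : Measure Ω) =
      eLpNorm f 2 (P' : Measure Ω) := by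
  rw [eLpNorm_two_eq, eLpNorm_two_eq,
    ← lintegral_rnDeriv_mul hac (f := fun o => ‖f o‖ₑ ^ 2) (by fun_prop)]
  congr 1
  refine lintegral_congr_ae ?_
  filter_upwards [Measure.rnDeriv_lt_top (P' : Measure Ω) (P : Measure Ω)] with o ho
  have h : ‖sqrtDensity P P' o‖ₑ ^ 2 = (P' : Measure Ω).rnDeriv (P : Measure Ω) o := by
    rw [← enorm_pow, pow_two, sqrtDensity_mul_self,
      Real.enorm_of_nonneg ENNReal.toReal_nonneg, ENNReal.ofReal_toReal ho.ne]
  rw [enorm_mul, mul_pow, h, mul_comm]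

lemma integral_eq_sqrtDensity (hac : (P' : Measure Ω) ≪ (P : Measure Ω)) (f : Ω → ℝ) :
    ∫ o, f o ∂(P' : Measure Ω) =
      ∫ o, f o * (sqrtDensity P P' o * sqrtDensity P P' o) ∂(P : Measure Ω) := by
  rw [← integral_rnDeriv_smul hac]
  refine integral_congr_ae (ae_of_all _ fun o => ?_)
  simp only [sqrtDensity_mul_self, smul_eq_mul, mul_comm]

lemma integrable_mul_sqrtDensity (hac : (P' : Measure Ω) ≪ (P : Measure Ω)) {f : Ω → ℝ}
    (hf : Integrable f (P' : Measure Ω)) :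
    Integrable (fun o => f o * (sqrtDensity P P' o * sqrtDensity P P' o)) (P : Measure Ω) := by
  refine ((integrable_rnDeriv_smul_iff hac).2 hf).congr (ae_of_all _ fun o => ?_)
  simp only [sqrtDensity_mul_self, smul_eq_mul, mul_comm]

/-- The factorisation r² - 1 = (r - 1)(r + 1) of the density difference: the first factor is of
order ε along a path, and f times the second is bounded in L₂ by second moments of f under both
laws. -/
lemma integral_sub_integral_eq (hac : (P' : Measure Ω) ≪ (P : Measure Ω)) {f : Ω → ℝ}
    (hf : Integrable f (P : Measure Ω)) (hf' : Integrable f (P' : Measure Ω)) :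
    Integrable (fun o => f o * (sqrtDensity P P' o - 1) * (sqrtDensity P P' o + 1))
        (P : Measure Ω) ∧
      ∫ o, f o ∂(P' : Measure Ω) - ∫ o, f o ∂(P : Measure Ω) =
        ∫ o, f o * (sqrtDensity P P' o - 1) * (sqrtDensity P P' o + 1) ∂(P : Measure Ω) := by
  have he : (fun o => f o * (sqrtDensity P P' o - 1) * (sqrtDensity P P' o + 1)) =
      fun o => f o * (sqrtDensity P P' o * sqrtDensity P P' o) - f o := by
    funext o; ring
  rw [he, integral_eq_sqrtDensity hac,
    integral_sub (integrable_mul_sqrtDensity hac hf') hf]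
  exact ⟨(integrable_mul_sqrtDensity hac hf').sub hf, rfl⟩

lemma eLpNorm_mul_sqrtDensity_add_one_le (hac : (P' : Measure Ω) ≪ (P : Measure Ω)) {f : Ω → ℝ}
    (hf : Measurable f) {C : ℝ≥0∞} (h : eLpNorm f 2 (P : Measure Ω) ≤ C)
    (h' : eLpNorm f 2 (P' : Measure Ω) ≤ C) :
    eLpNorm (fun o => f o * (sqrtDensity P P' o + 1)) 2 (P : Measure Ω) ≤ 2 * C := by
  have he : (fun o => f o * (sqrtDensity P P' o + 1)) =
      (fun o => f o * sqrtDensity P P' o) + f := by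
    funext o; simp only [Pi.add_apply]; ring
  rw [he, two_mul]
  refine (eLpNorm_add_le (hf.mul measurable_sqrtDensity).aestronglyMeasurable
    hf.aestronglyMeasurable (by norm_num)).trans (add_le_add ?_ h)
  exact (eLpNorm_mul_sqrtDensity hac hf).trans_le h'

lemma eLpNorm_mul_sqrtDensity_sub_one_le (hac : (P' : Measure Ω) ≪ (P : Measure Ω)) {f : Ω → ℝ}
    (hf : Measurable f) {C : ℝ≥0∞} (h : eLpNorm f 2 (P : Measure Ω) ≤ C)
    (h' : eLpNorm f 2 (P' : Measure Ω) ≤ C) :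
    eLpNorm (fun o => f o * (sqrtDensity P P' o - 1)) 2 (P : Measure Ω) ≤ 2 * C := by
  have he : (fun o => f o * (sqrtDensity P P' o - 1)) =
      (fun o => f o * sqrtDensity P P' o) - f := by
    funext o; simp only [Pi.sub_apply]; ring
  rw [he, two_mul]
  refine (eLpNorm_sub_le (hf.mul measurable_sqrtDensity).aestronglyMeasurable
    hf.aestronglyMeasurable (by norm_num)).trans (add_le_add ?_ h)
  exact (eLpNorm_mul_sqrtDensity hac hf).trans_le h'

/-- The Hellinger bound for the difference of two means of a bounded function. -/
lemma abs_integral_sub_le (hac : (P' : Measure Ω) ≪ (P : Measure Ω)) {u : Ω → ℝ}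
    (hu : Measurable u) {K : ℝ} (hK : ∀ o, |u o| ≤ K)
    (hfin : eLpNorm (fun o => sqrtDensity P P' o - 1) 2 (P : Measure Ω) ≠ ∞) :
    |∫ o, u o ∂(P' : Measure Ω) - ∫ o, u o ∂(P : Measure Ω)| ≤
      2 * K * (eLpNorm (fun o => sqrtDensity P P' o - 1) 2 (P : Measure Ω)).toReal := by
  have hi (Q : ProbabilityMeasure Ω) : Integrable u (Q : Measure Ω) :=
    Integrable.of_bound hu.aestronglyMeasurable K (ae_of_all _ hK)
  have hn (Q : ProbabilityMeasure Ω) : eLpNorm u 2 (Q : Measure Ω) ≤ ENNReal.ofReal K := by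
    refine (eLpNorm_le_of_ae_bound (ae_of_all _ hK)).trans ?_
    simp
  rw [(integral_sub_integral_eq hac (hi P) (hi P')).2]
  have hs := measurable_sqrtDensity (P := P) (P' := P')
  have h := enorm_integral_mul_le (μ := (P : Measure Ω))
    (f := fun o => u o * (sqrtDensity P P' o + 1)) (g := fun o => sqrtDensity P P' o - 1)
    (by fun_prop) (by fun_prop)
  have h2 := h.trans (mul_le_mul_left
    (eLpNorm_mul_sqrtDensity_add_one_le hac hu (hn P) (hn P')) _)
  have h3 := ENNReal.toReal_mono (by finiteness) h2
  have hK0 : 0 ≤ K := by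
    obtain ⟨o⟩ : Nonempty Ω := (P : Measure Ω).nonempty_of_neZero
    exact (abs_nonneg _).trans (hK o)
  rw [ENNReal.toReal_mul, ENNReal.toReal_mul, ENNReal.toReal_ofReal hK0, toReal_enorm,
    Real.norm_eq_abs] at h3
  refine le_trans (le_of_eq ?_) h3
  congr 1
  exact integral_congr_ae (ae_of_all _ fun o => by ring)

lemma exists_eLpNorm_tail_le {S : Ω → ℝ} (hS : MemLp S 2 (P : Measure Ω)) {δ : ℝ} (hδ : 0 < δ) :
    ∃ N : ℝ, 0 ≤ N ∧
      eLpNorm (fun o => if N ≤ |S o| then S o else 0) 2 (P : Measure Ω) ≤ ENNReal.ofReal δ := by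
  have hmk := hS.1.ae_eq_mk
  obtain ⟨M, hM⟩ := (hS.ae_eq hmk).eLpNorm_indicator_norm_ge_le hS.1.stronglyMeasurable_mk hδ
  -- The level is made nonnegative because it later bounds the truncated score, including where that
  -- is zero.
  refine ⟨max M 0, le_max_right _ _, ?_⟩
  refine (eLpNorm_mono_ae ?_).trans hM
  filter_upwards [hmk] with o ho
  by_cases h : max M 0 ≤ |S o|
  · rw [if_pos h, Set.indicator_of_mem, ← ho]
    have := (le_max_left M 0).trans h
    rw [ho] at this
    exact this
  · rw [if_neg h, norm_zero]
    exact norm_nonneg _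

/-- Bounded multipliers which vanish asymptotically in a weighted mean, for a positive weight,
vanish asymptotically against any square integrable function. -/
lemma tendsto_eLpNorm_mul_of_weighted {ι : Type*} {l : Filter ι} {m : ι → Ω → ℝ}
    (hm : ∀ i, Measurable (m i)) {K : ℝ} (hK : ∀ i o, |m i o| ≤ K) {w : Ω → ℝ}
    (hw : Measurable w) (hw0 : ∀ᵐ o ∂(P : Measure Ω), 0 < w o)
    (hlim : Tendsto (fun i => ∫⁻ o, ENNReal.ofReal (w o) * ‖m i o‖ₑ ∂(P : Measure Ω)) l (𝓝 0))
    {S : Ω → ℝ} (hS : MemLp S 2 (P : Measure Ω)) :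
    Tendsto (fun i => eLpNorm (fun o => m i o * S o) 2 (P : Measure Ω)) l (𝓝 0) := by
  wlog hSm : Measurable S generalizing S
  · have h := this (hS.ae_eq hS.1.ae_eq_mk) hS.1.stronglyMeasurable_mk.measurable
    refine h.congr fun i => eLpNorm_congr_ae ?_
    filter_upwards [hS.1.ae_eq_mk] with o ho
    rw [← ho]
  have hSfin : ∫⁻ o, ‖S o‖ₑ ^ 2 ∂(P : Measure Ω) ≠ ∞ := by
    have := hS.2
    rw [eLpNorm_two_eq] at this
    intro h
    rw [h] at this
    simp at this
  -- Split according to whether S² exceeds N w. Where it does not, m² S² ≤ K N w |m|, whose integral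
  -- vanishes for fixed N. Where it does, m² S² ≤ K² S², whose integral is small for large N because
  -- w > 0 almost everywhere.
  have key : Tendsto (fun i => ∫⁻ o, ‖m i o * S o‖ₑ ^ 2 ∂(P : Measure Ω)) l (𝓝 0) := by
    refine tendsto_zero_of_forall_le_add (C := ENNReal.ofReal K * ENNReal.ofReal K)
      (by finiteness) fun δ hδ => ?_
    have htail : Tendsto (fun N : ℕ => ∫⁻ o, {o | (N : ℝ≥0∞) * ENNReal.ofReal (w o) <
        ‖S o‖ₑ ^ 2}.indicator (fun o => ‖S o‖ₑ ^ 2) o ∂(P : Measure Ω)) atTop (𝓝 0) := by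
      have := tendsto_lintegral_of_dominated_convergence (μ := (P : Measure Ω))
        (F := fun (N : ℕ) o => {o | (N : ℝ≥0∞) * ENNReal.ofReal (w o) <
          ‖S o‖ₑ ^ 2}.indicator (fun o => ‖S o‖ₑ ^ 2) o) (f := fun _ => 0)
        (fun o => ‖S o‖ₑ ^ 2)
        (fun N => Measurable.indicator (by fun_prop)
          (measurableSet_lt (by fun_prop) (by fun_prop)))
        (fun N => ae_of_all _ fun o => Set.indicator_le_self _ _ _) hSfin ?_
      · simpa using this
      · filter_upwards [hw0] with o ho
        obtain ⟨N₀, hN₀⟩ := ENNReal.exists_nat_mul_gt (a := ENNReal.ofReal (w o))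
          (b := ‖S o‖ₑ ^ 2) (by simpa using ho) (by finiteness)
        refine tendsto_const_nhds.congr' ?_
        filter_upwards [eventually_ge_atTop N₀] with N hN
        rw [Set.indicator_of_notMem]
        simp only [Set.mem_ofPred_eq, not_lt]
        refine hN₀.le.trans ?_
        gcongr
    obtain ⟨N, hN⟩ := ((ENNReal.tendsto_nhds_zero.1 htail (ENNReal.ofReal δ)
      (by simpa using hδ))).exists
    refine ⟨fun i => ENNReal.ofReal K * (N * ∫⁻ o, ENNReal.ofReal (w o) * ‖m i o‖ₑ
      ∂(P : Measure Ω)), ?_, Eventually.of_forall fun i => ?_⟩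
    · have := ENNReal.Tendsto.const_mul (a := ENNReal.ofReal K) (ENNReal.Tendsto.const_mul
        (a := (N : ℝ≥0∞)) hlim (Or.inr (by finiteness))) (Or.inr (by finiteness))
      simpa using this
    · have hmK (o : Ω) : ‖m i o‖ₑ ≤ ENNReal.ofReal K := by
        rw [← ofReal_norm]
        exact ENNReal.ofReal_le_ofReal (hK i o)
      calc ∫⁻ o, ‖m i o * S o‖ₑ ^ 2 ∂(P : Measure Ω)
          ≤ ∫⁻ o, (ENNReal.ofReal K * (N * (ENNReal.ofReal (w o) * ‖m i o‖ₑ)) +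
            ENNReal.ofReal K * ENNReal.ofReal K * {o | (N : ℝ≥0∞) * ENNReal.ofReal (w o) <
              ‖S o‖ₑ ^ 2}.indicator (fun o => ‖S o‖ₑ ^ 2) o) ∂(P : Measure Ω) := by
            refine lintegral_mono fun o => ?_
            simp only [enorm_mul, mul_pow]
            by_cases ho : (N : ℝ≥0∞) * ENNReal.ofReal (w o) < ‖S o‖ₑ ^ 2
            · rw [Set.indicator_of_mem (by exact ho)]
              refine le_add_left ?_
              rw [sq ‖m i o‖ₑ]
              exact mul_le_mul' (mul_le_mul' (hmK o) (hmK o)) le_rfl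
            · refine le_add_right ?_
              rw [sq ‖m i o‖ₑ, mul_assoc]
              refine mul_le_mul' (hmK o) ?_
              rw [← mul_assoc, mul_comm ‖m i o‖ₑ]
              exact mul_le_mul' (not_lt.1 ho) le_rfl
        _ = ENNReal.ofReal K * (N * ∫⁻ o, ENNReal.ofReal (w o) * ‖m i o‖ₑ ∂(P : Measure Ω)) +
            ENNReal.ofReal K * ENNReal.ofReal K * ∫⁻ o, {o | (N : ℝ≥0∞) * ENNReal.ofReal (w o) <
              ‖S o‖ₑ ^ 2}.indicator (fun o => ‖S o‖ₑ ^ 2) o ∂(P : Measure Ω) := by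
            have hmi := hm i
            rw [lintegral_add_left (by fun_prop), lintegral_const_mul _ (by fun_prop),
              lintegral_const_mul _ (by fun_prop), lintegral_const_mul]
            exact Measurable.indicator (by fun_prop)
              (measurableSet_lt (by fun_prop) (by fun_prop))
        _ ≤ _ := by gcongr
  have h2 := (ENNReal.continuous_rpow_const (y := (1 / 2 : ℝ))).tendsto 0 |>.comp key
  rw [ENNReal.zero_rpow_of_pos (by norm_num)] at h2
  exact h2.congr fun i => (eLpNorm_two_eq _ _).symm

variable {Pt : ℝ → ProbabilityMeasure Ω} {S : Ω → ℝ}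

/-- The remainder of the square root density in the definition of quadratic mean
differentiability. -/
noncomputable def qmdRemainder (P : ProbabilityMeasure Ω) (Pt : ℝ → ProbabilityMeasure Ω)
    (S : Ω → ℝ) (ε : ℝ) (o : Ω) : ℝ :=
  (sqrtDensity P (Pt ε) o - 1) / ε - S o / 2

lemma IsQMDPath.aestronglyMeasurable_remainder (h : IsQMDPath P Pt S) (ε : ℝ) :
    AEStronglyMeasurable (qmdRemainder P Pt S ε) (P : Measure Ω) := by
  have hs := measurable_sqrtDensity (P := P) (P' := Pt ε)
  have hS := h.score_memLp.1
  unfold qmdRemainder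
  exact ((hs.sub_const 1).div_const ε).aestronglyMeasurable.sub
    (hS.aemeasurable.div_const 2).aestronglyMeasurable

lemma IsQMDPath.tendsto_remainder (h : IsQMDPath P Pt S) :
    Tendsto (fun ε => eLpNorm (qmdRemainder P Pt S ε) 2 (P : Measure Ω)) (𝓝[≠] 0) (𝓝 0) :=
  h.qmd

lemma sqrtDensity_sub_one {ε : ℝ} (hε : ε ≠ 0) (o : Ω) :
    sqrtDensity P (Pt ε) o - 1 = ε * (qmdRemainder P Pt S ε o + S o / 2) := by
  unfold qmdRemainder; field_simp; ring

lemma IsQMDPath.tendsto_sqrtDensity (h : IsQMDPath P Pt S) :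
    Tendsto (fun ε => eLpNorm (fun o => sqrtDensity P (Pt ε) o - 1) 2 (P : Measure Ω))
      (𝓝[≠] 0) (𝓝 0) := by
  have hS : MemLp (fun o => S o / 2) 2 (P : Measure Ω) := by
    simpa [div_eq_inv_mul] using h.score_memLp.const_mul (2⁻¹ : ℝ)
  have h1 : Tendsto (fun ε : ℝ => ‖ε‖ₑ) (𝓝[≠] 0) (𝓝 0) := by
    have := (continuous_enorm (E := ℝ)).tendsto 0
    rw [enorm_zero] at this
    exact this.mono_left nhdsWithin_le_nhds
  have h2 := ENNReal.Tendsto.mul h1 (Or.inr ?_)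
    (h.tendsto_remainder.add (tendsto_const_nhds (x := eLpNorm (fun o => S o / 2) 2 (P : Measure Ω))))
    (Or.inr (by simp))
  · rw [zero_mul] at h2
    refine tendsto_of_tendsto_of_tendsto_of_le_of_le' tendsto_const_nhds h2
      (Eventually.of_forall fun _ => zero_le) ?_
    filter_upwards [self_mem_nhdsWithin] with ε hε
    have he : (fun o => sqrtDensity P (Pt ε) o - 1) =
        ε • (qmdRemainder P Pt S ε + fun o => S o / 2) := by
      funext o; exact sqrtDensity_sub_one hε o
    rw [he, eLpNorm_const_smul]
    gcongr
    exact eLpNorm_add_le (h.aestronglyMeasurable_remainder ε) hS.1 (by norm_num)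
  · rw [zero_add]; exact hS.2.ne

lemma hasDerivAt_of_tendsto_enorm {T : ℝ → ℝ} {L : ℝ}
    (h : Tendsto (fun ε => ‖ε⁻¹ * (T ε - T 0) - L‖ₑ) (𝓝[≠] 0) (𝓝 0)) : HasDerivAt T L 0 := by
  rw [hasDerivAt_iff_tendsto_slope, tendsto_iff_edist_tendsto_0]
  refine h.congr fun ε => ?_
  rw [edist_eq_enorm_sub, slope_def_field, sub_zero, div_eq_inv_mul]

lemma integrable_of_eLpNorm_two_le {f : Ω → ℝ} (hf : Measurable f) {C : ℝ≥0∞} (hC : C ≠ ∞)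
    (h : eLpNorm f 2 (P : Measure Ω) ≤ C) : Integrable f (P : Measure Ω) :=
  MemLp.integrable (q := 2) (by norm_num) ⟨hf.aestronglyMeasurable, h.trans_lt hC.lt_top⟩

/-- Along a path differentiable in quadratic mean, the mean of a function with locally bounded
second moments is differentiable, with derivative given by the score. -/
lemma IsQMDPath.hasDerivAt_integral (h : IsQMDPath P Pt S) {f : Ω → ℝ} (hf : Measurable f)
    {C : ℝ≥0∞} (hC : C ≠ ∞) (hb : ∀ᶠ ε in 𝓝 (0 : ℝ), eLpNorm f 2 (Pt ε : Measure Ω) ≤ C) :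
    HasDerivAt (fun ε => ∫ o, f o ∂(Pt ε : Measure Ω)) (∫ o, f o * S o ∂(P : Measure Ω)) 0 := by
  have hfP : eLpNorm f 2 (P : Measure Ω) ≤ C := by
    have := hb.self_of_nhds
    rwa [h.through] at this
  have hfL : MemLp f 2 (P : Measure Ω) := ⟨hf.aestronglyMeasurable, hfP.trans_lt hC.lt_top⟩
  have hfS : Integrable (fun o => f o * S o) (P : Measure Ω) := hfL.integrable_mul h.score_memLp
  have hSm := h.score_memLp.1
  apply hasDerivAt_of_tendsto_enorm
  -- For unbounded f, the bounds at hand keep f (r - 1) bounded in L₂ without making it small, so S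
  -- is truncated at N: the tail of S contributes at most a multiple of δ, and the bounded part is
  -- paired with ‖r - 1‖ → 0.
  refine tendsto_zero_of_forall_le_add (C := 2 * C) (by finiteness) fun δ hδ => ?_
  obtain ⟨N, hN0, hN⟩ := exists_eLpNorm_tail_le h.score_memLp hδ
  refine ⟨fun ε => 2 * C * eLpNorm (qmdRemainder P Pt S ε) 2 (P : Measure Ω) +
    C * (ENNReal.ofReal N * eLpNorm (fun o => sqrtDensity P (Pt ε) o - 1) 2 (P : Measure Ω)),
    ?_, ?_⟩
  · have h1 := ENNReal.Tendsto.const_mul (a := 2 * C) h.tendsto_remainder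
      (Or.inr (by finiteness))
    have h2 := ENNReal.Tendsto.const_mul (a := C) (ENNReal.Tendsto.const_mul
      (a := ENNReal.ofReal N) h.tendsto_sqrtDensity (Or.inr (by finiteness))) (Or.inr hC)
    simpa using h1.add h2
  filter_upwards [self_mem_nhdsWithin, h.dominated.filter_mono nhdsWithin_le_nhds,
    hb.filter_mono nhdsWithin_le_nhds] with ε hε hac hbε
  have hs := measurable_sqrtDensity (P := P) (P' := Pt ε)
  obtain ⟨hi, he⟩ := integral_sub_integral_eq hac (integrable_of_eLpNorm_two_le hf hC hfP)
    (integrable_of_eLpNorm_two_le hf hC hbε)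
  set r := sqrtDensity P (Pt ε) with hr
  set ρ := qmdRemainder P Pt S ε with hρ
  have hρm : AEStronglyMeasurable ρ (P : Measure Ω) := h.aestronglyMeasurable_remainder ε
  have hsub (o : Ω) : r o - 1 = ε * (ρ o + S o / 2) := sqrtDensity_sub_one hε o
  set Sb : Ω → ℝ := fun o => if N ≤ |S o| then 0 else S o with hSb
  set Su : Ω → ℝ := fun o => if N ≤ |S o| then S o else 0 with hSu
  have hsplit : ∀ o, S o = Sb o + Su o := by
    intro o; simp only [hSb, hSu]; split_ifs <;> simp
  have hSbm : AEStronglyMeasurable Sb (P : Measure Ω) := by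
    have : Measurable (fun t : ℝ => if N ≤ |t| then 0 else t) :=
      Measurable.ite (measurableSet_le measurable_const measurable_abs) measurable_const
        measurable_id
    exact (this.comp_aemeasurable hSm.aemeasurable).aestronglyMeasurable
  have hSum : AEStronglyMeasurable Su (P : Measure Ω) := by
    have : Measurable (fun t : ℝ => if N ≤ |t| then t else 0) :=
      Measurable.ite (measurableSet_le measurable_const measurable_abs) measurable_id
        measurable_const
    exact (this.comp_aemeasurable hSm.aemeasurable).aestronglyMeasurable
  have hadd := eLpNorm_mul_sqrtDensity_add_one_le hac hf hfP hbε
  have hsubn := eLpNorm_mul_sqrtDensity_sub_one_le hac hf hfP hbε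
  have hrm : MemLp (fun o => f o * (r o - 1)) 2 (P : Measure Ω) :=
    ⟨(hf.mul (hs.sub_const 1)).aestronglyMeasurable, hsubn.trans_lt (by finiteness)⟩
  have hrp : MemLp (fun o => f o * (r o + 1)) 2 (P : Measure Ω) :=
    ⟨(hf.mul (hs.add_const 1)).aestronglyMeasurable, hadd.trans_lt (by finiteness)⟩
  have hSuL : MemLp Su 2 (P : Measure Ω) := ⟨hSum, hN.trans_lt (by finiteness)⟩
  have hSbL : MemLp Sb 2 (P : Measure Ω) := by
    refine (h.score_memLp.sub hSuL).ae_eq (ae_of_all _ fun o => ?_)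
    simp [hsplit o]
  have hiu : Integrable (fun o => f o * (r o - 1) * Su o) (P : Measure Ω) :=
    hrm.integrable_mul hSuL
  have hib : Integrable (fun o => f o * (r o - 1) * Sb o) (P : Measure Ω) :=
    hrm.integrable_mul hSbL
  have hipS : Integrable (fun o => f o * (r o + 1) * S o) (P : Measure Ω) :=
    hrp.integrable_mul h.score_memLp
  have hiρ : Integrable (fun o => f o * (r o + 1) * ρ o) (P : Measure Ω) := by
    refine ((hi.const_mul ε⁻¹).sub (hipS.const_mul (1 / 2))).congr (ae_of_all _ fun o => ?_)
    simp only [Pi.sub_apply, hsub o]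
    have : ε ≠ 0 := hε
    field_simp
    ring
  -- Substituting r - 1 = ε (ρ + S / 2) and writing (r + 1) S / 2 - S = (r - 1) S / 2.
  have hmain : ε⁻¹ * (∫ o, f o ∂(Pt ε : Measure Ω) - ∫ o, f o ∂(Pt 0 : Measure Ω)) -
      ∫ o, f o * S o ∂(P : Measure Ω) = ∫ o, f o * (r o + 1) * ρ o ∂(P : Measure Ω) +
        1 / 2 * (∫ o, f o * (r o - 1) * Sb o ∂(P : Measure Ω) +
          ∫ o, f o * (r o - 1) * Su o ∂(P : Measure Ω)) := by
    rw [h.through, he, ← integral_const_mul, ← integral_sub (hi.const_mul _) hfS,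
      ← integral_add' hib hiu, ← integral_const_mul,
      ← integral_add hiρ (Integrable.const_mul (hib.add hiu) _)]
    refine integral_congr_ae (ae_of_all _ fun o => ?_)
    have hε' : ε ≠ 0 := hε
    have h1 : ε⁻¹ * (f o * (r o - 1) * (r o + 1)) = f o * (ρ o + S o / 2) * (r o + 1) := by
      rw [hsub o]; field_simp
    simp only [h1, hsplit o, Pi.add_apply]
    ring
  rw [hmain]
  have hhalf (x : ℝ) : ‖1 / 2 * x‖ₑ ≤ ‖x‖ₑ := by
    rw [enorm_le_iff_norm_le, norm_mul]
    norm_num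
    linarith [abs_nonneg x]
  have e1 : ‖∫ o, f o * (r o + 1) * ρ o ∂(P : Measure Ω)‖ₑ ≤
      2 * C * eLpNorm ρ 2 (P : Measure Ω) :=
    (enorm_integral_mul_le hrp.1 hρm).trans (mul_le_mul_left hadd _)
  have e2 : ‖∫ o, f o * (r o - 1) * Su o ∂(P : Measure Ω)‖ₑ ≤ 2 * C * ENNReal.ofReal δ :=
    (enorm_integral_mul_le hrm.1 hSum).trans (mul_le_mul' hsubn hN)
  have e3 : ‖∫ o, f o * (r o - 1) * Sb o ∂(P : Measure Ω)‖ₑ ≤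
      C * (ENNReal.ofReal N * eLpNorm (fun o => r o - 1) 2 (P : Measure Ω)) := by
    simp_rw [mul_assoc]
    refine (enorm_integral_mul_le hf.aestronglyMeasurable
      ((hs.sub_const 1).aestronglyMeasurable.mul hSbm)).trans (mul_le_mul' hfP ?_)
    refine eLpNorm_le_mul_eLpNorm_of_ae_le_mul (ae_of_all _ fun o => ?_) 2
    rw [Pi.mul_apply, norm_mul, mul_comm]
    refine mul_le_mul_of_nonneg_right ?_ (norm_nonneg _)
    simp only [hSb]
    split_ifs with hlt
    · simpa using hN0
    · exact (not_le.1 hlt).le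
  calc _ ≤ _ := enorm_add_le _ _
    _ ≤ _ := add_le_add e1 ((hhalf _).trans ((enorm_add_le _ _).trans (add_le_add e3 e2)))
    _ = _ := by rw [add_assoc]

/-- Differentiate the constant total mass, that is, the mean of f = 1. -/
lemma IsQMDPath.integral_score (h : IsQMDPath P Pt S) : ∫ o, S o ∂(P : Measure Ω) = 0 := by
  have h1 := h.hasDerivAt_integral (f := fun _ => 1) measurable_const (C := 1) (by simp)
    (Eventually.of_forall fun ε => by
      rw [eLpNorm_const _ (by norm_num) (NeZero.ne _)]; simp)
  simp only [one_mul, integral_const, probReal_univ, smul_eq_mul] at h1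
  exact h1.unique (hasDerivAt_const 0 _)

/-- The means of a function with locally bounded second moments, multiplied by bounded functions
which vanish asymptotically and are orthogonal to it under `P`, are of smaller order than `ε`. -/
lemma IsQMDPath.hasDerivAt_integral_mul_zero (h : IsQMDPath P Pt S) {f : Ω → ℝ}
    (hf : Measurable f) {C : ℝ≥0∞} (hC : C ≠ ∞)
    (hb : ∀ᶠ ε in 𝓝 (0 : ℝ), eLpNorm f 2 (Pt ε : Measure Ω) ≤ C)
    {m : ℝ → Ω → ℝ} (hm : ∀ ε, Measurable (m ε)) {K : ℝ} (hK : ∀ ε o, |m ε o| ≤ K)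
    (hlim : Tendsto (fun ε => eLpNorm (fun o => m ε o * S o) 2 (P : Measure Ω)) (𝓝[≠] 0) (𝓝 0))
    (horth : ∀ ε, ∫ o, m ε o * f o ∂(P : Measure Ω) = 0) :
    HasDerivAt (fun ε => ∫ o, m ε o * f o ∂(Pt ε : Measure Ω)) 0 0 := by
  have hfP : eLpNorm f 2 (P : Measure Ω) ≤ C := by
    have := hb.self_of_nhds
    rwa [h.through] at this
  have hSm := h.score_memLp.1
  apply hasDerivAt_of_tendsto_enorm
  have hup : Tendsto (fun ε => 2 * C * (ENNReal.ofReal K *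
      eLpNorm (qmdRemainder P Pt S ε) 2 (P : Measure Ω) +
        eLpNorm (fun o => m ε o * S o) 2 (P : Measure Ω))) (𝓝[≠] 0) (𝓝 0) := by
    have := ENNReal.Tendsto.const_mul (a := 2 * C) ((ENNReal.Tendsto.const_mul
      (a := ENNReal.ofReal K) h.tendsto_remainder (Or.inr (by finiteness))).add hlim)
      (Or.inr (by finiteness))
    simpa using this
  refine tendsto_of_tendsto_of_tendsto_of_le_of_le' tendsto_const_nhds hup
    (Eventually.of_forall fun _ => zero_le) ?_
  filter_upwards [self_mem_nhdsWithin, h.dominated.filter_mono nhdsWithin_le_nhds,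
    hb.filter_mono nhdsWithin_le_nhds] with ε hε hac hbε
  have hs := measurable_sqrtDensity (P := P) (P' := Pt ε)
  have hmε := hm ε
  have hbdd (Q : ProbabilityMeasure Ω) (hQ : eLpNorm f 2 (Q : Measure Ω) ≤ C) :
      Integrable (fun o => m ε o * f o) (Q : Measure Ω) :=
    (integrable_of_eLpNorm_two_le hf hC hQ).bdd_mul (hm ε).aestronglyMeasurable
      (ae_of_all _ (hK ε))
  obtain ⟨hi, he⟩ := integral_sub_integral_eq hac (hbdd P hfP) (hbdd (Pt ε) hbε)
  rw [horth, sub_zero] at he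
  rw [h.through, horth, sub_zero, sub_zero, he, ← integral_const_mul]
  set r := sqrtDensity P (Pt ε) with hr
  set ρ := qmdRemainder P Pt S ε with hρ
  have hρm : AEStronglyMeasurable ρ (P : Measure Ω) := h.aestronglyMeasurable_remainder ε
  -- No truncation of S is needed here: m S itself tends to zero in L₂, and m ρ does since m is
  -- bounded.
  have heq : (fun o => ε⁻¹ * (m ε o * f o * (r o - 1) * (r o + 1))) =
      fun o => (f o * (r o + 1)) * (m ε o * ρ o + m ε o * S o / 2) := by
    funext o
    have hε' : ε ≠ 0 := hε
    have hsub : r o - 1 = ε * (ρ o + S o / 2) := sqrtDensity_sub_one hε o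
    rw [hsub]
    field_simp
  have hmρ : AEStronglyMeasurable (fun o => m ε o * ρ o) (P : Measure Ω) :=
    hmε.aestronglyMeasurable.mul hρm
  have hmS : AEStronglyMeasurable (fun o => m ε o * S o / 2) (P : Measure Ω) :=
    ((hmε.aemeasurable.mul hSm.aemeasurable).div_const 2).aestronglyMeasurable
  rw [heq]
  refine (enorm_integral_mul_le (hf.mul (hs.add_const 1)).aestronglyMeasurable
    (hmρ.add hmS)).trans (mul_le_mul'
      (eLpNorm_mul_sqrtDensity_add_one_le hac hf hfP hbε) ?_)
  refine (eLpNorm_add_le hmρ hmS (by norm_num)).trans (add_le_add ?_ ?_)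
  · refine eLpNorm_le_mul_eLpNorm_of_ae_le_mul (ae_of_all _ fun o => ?_) 2
    rw [norm_mul]
    exact mul_le_mul_of_nonneg_right (hK ε o) (norm_nonneg _)
  · refine eLpNorm_mono fun o => ?_
    rw [norm_div]
    norm_num
    linarith [mul_nonneg (abs_nonneg (m ε o)) (abs_nonneg (S o))]

end QuadraticMean


/-! ### Expansion of ψ and its pathwise derivative -/

section Derivative

variable {𝒳 𝒲 : Type*} [MeasurableSpace 𝒳] [MeasurableSpace 𝒲]
  {P P' : ProbabilityMeasure (Obs 𝒳 𝒲)}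

/-- The relative error of the treatment probability of `P'`, truncated so as to be bounded. -/
noncomputable def relProbError (P P' : ProbabilityMeasure (Obs 𝒳 𝒲)) (c : ℝ) (a : Bool)
    (v : 𝒲 × 𝒳) : ℝ :=
  (armProb P a v - armProb P' a v) / max (armProb P' a v) (c * armProb P a v)

lemma measurable_relProbError (c : ℝ) (a : Bool) : Measurable (relProbError P P' c a) :=
  ((measurable_armProb P a).sub (measurable_armProb P' a)).div
    ((measurable_armProb P' a).max ((measurable_armProb P a).const_mul c))

lemma abs_relProbError_le {c : ℝ} (hc : 0 < c) (a : Bool) (v : 𝒲 × 𝒳) :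
    |relProbError P P' c a v| ≤ 1 + c⁻¹ := by
  have h1 := armProb_nonneg P a v
  have h2 := armProb_nonneg P' a v
  have h3 := le_max_left (armProb P' a v) (c * armProb P a v)
  have h4 := le_max_right (armProb P' a v) (c * armProb P a v)
  rw [relProbError, abs_div, abs_of_nonneg (h2.trans h3)]
  refine div_le_of_le_mul₀ (h2.trans h3) (by positivity) ?_
  have h5 : armProb P a v ≤ c⁻¹ * max (armProb P' a v) (c * armProb P a v) := by
    rw [inv_mul_eq_div, le_div_iff₀ hc, mul_comm]; exact h4
  rw [abs_le]
  constructor <;> linarith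

lemma armProb_mul_abs_relProbError_le {c : ℝ} (hc : 0 < c) (a : Bool) (v : 𝒲 × 𝒳) :
    armProb P a v * |relProbError P P' c a v| ≤ c⁻¹ * |armProb P a v - armProb P' a v| := by
  have h1 := armProb_nonneg P a v
  have h2 := armProb_nonneg P' a v
  have h3 := le_max_left (armProb P' a v) (c * armProb P a v)
  have h4 := le_max_right (armProb P' a v) (c * armProb P a v)
  rw [relProbError, abs_div, abs_of_nonneg (h2.trans h3), ← mul_div_assoc]
  refine div_le_of_le_mul₀ (h2.trans h3) (by positivity) ?_
  have h5 : armProb P a v ≤ c⁻¹ * max (armProb P' a v) (c * armProb P a v) := by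
    rw [inv_mul_eq_div, le_div_iff₀ hc, mul_comm]; exact h4
  calc _ ≤ (c⁻¹ * max (armProb P' a v) (c * armProb P a v)) *
        |armProb P a v - armProb P' a v| := mul_le_mul_of_nonneg_right h5 (abs_nonneg _)
    _ = _ := by ring

lemma integrable_bounded_covar (Q : ProbabilityMeasure (Obs 𝒳 𝒲)) {f : 𝒲 × 𝒳 → ℝ}
    (hf : Measurable f) {K : ℝ} (hK : ∀ v, |f v| ≤ K) :
    Integrable (fun o => f (covar o)) (Q : Measure (Obs 𝒳 𝒲)) :=
  Integrable.of_bound (hf.comp measurable_covar).aestronglyMeasurable K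
    (ae_of_all _ fun _ => hK _)

lemma abs_armProb_sub_le (a : Bool) (v : 𝒲 × 𝒳) : |armProb P a v - armProb P' a v| ≤ 1 := by
  have h1 := armProb_nonneg P a v
  have h2 := armProb_nonneg P' a v
  have h3 := armProb_le_one P a v
  have h4 := armProb_le_one P' a v
  rw [abs_le]; constructor <;> linarith

/-- With σ(V) the sign of π' - π, the left side is E'[σ (π' - π)] = E'[σ (1{A = a} - π)]. The same
integrand has mean zero under P, so the Hellinger bound for a function bounded by one applies. -/
lemma integral_abs_armProb_sub_le (hac : (P' : Measure (Obs 𝒳 𝒲)) ≪ (P : Measure (Obs 𝒳 𝒲)))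
    (hfin : eLpNorm (fun o => sqrtDensity P P' o - 1) 2 (P : Measure (Obs 𝒳 𝒲)) ≠ ∞)
    (a : Bool) :
    ∫ o, |armProb P a (covar o) - armProb P' a (covar o)| ∂(P' : Measure (Obs 𝒳 𝒲)) ≤
      2 * (eLpNorm (fun o => sqrtDensity P P' o - 1) 2 (P : Measure (Obs 𝒳 𝒲))).toReal := by
  set σ : 𝒲 × 𝒳 → ℝ := fun v => if armProb P a v ≤ armProb P' a v then 1 else -1 with hσ
  have hσm : Measurable σ := Measurable.ite
    (measurableSet_le (measurable_armProb P a) (measurable_armProb P' a)) measurable_const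
    measurable_const
  have hσ1 (v : 𝒲 × 𝒳) : |σ v| = 1 := by simp only [hσ]; split_ifs <;> simp
  have hσabs (v : 𝒲 × 𝒳) : |armProb P a v - armProb P' a v| =
      σ v * armProb P' a v - σ v * armProb P a v := by
    simp only [hσ]
    split_ifs with h
    · rw [abs_of_nonpos (by linarith)]; ring
    · rw [abs_of_pos (by linarith)]; ring
  have hind (Q : ProbabilityMeasure (Obs 𝒳 𝒲)) :
      Integrable (fun o => σ (covar o) * armInd a o) (Q : Measure (Obs 𝒳 𝒲)) :=
    (integrable_armInd a).bdd_mul (c := 1) (hσm.comp measurable_covar).aestronglyMeasurable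
      (ae_of_all _ fun o => (hσ1 _).le)
  have hprob (Q : ProbabilityMeasure (Obs 𝒳 𝒲)) :
      Integrable (fun o => σ (covar o) * armProb P a (covar o)) (Q : Measure (Obs 𝒳 𝒲)) :=
    integrable_bounded_covar Q (f := fun v => σ v * armProb P a v)
      (hσm.mul (measurable_armProb P a)) (K := 1) fun v => by
        rw [abs_mul, hσ1, one_mul, abs_of_nonneg (armProb_nonneg P a v)]
        exact armProb_le_one P a v
  have h1 := integrable_mul_armProb hσm (hind P')
  have h0 := integrable_mul_armProb hσm (hind P)
  have hu := abs_integral_sub_le hac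
    (u := fun o => σ (covar o) * armInd a o - σ (covar o) * armProb P a (covar o))
    (((hσm.comp measurable_covar).mul (measurable_armInd a)).sub
      ((hσm.comp measurable_covar).mul ((measurable_armProb P a).comp measurable_covar)))
    (K := 1) (fun o => by
      rw [← mul_sub, abs_mul, hσ1, one_mul]
      have h1 := armProb_nonneg P a (covar o)
      have h2 := armInd_nonneg a o
      have h3 := armProb_le_one P a (covar o)
      have h4 := armInd_le_one a o
      rw [abs_le]; constructor <;> linarith) hfin
  rw [integral_sub (hind P') (hprob P'), integral_sub (hind P) (hprob P), ← h1.2, ← h0.2,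
    sub_self, sub_zero, mul_one] at hu
  simp_rw [hσabs]
  rw [integral_sub h1.1 (hprob P')]
  exact (le_abs_self _).trans hu

/-- The weight π |m| is at most |π - π'| / c, whose mean under P' costs 2 / c Hellinger distances.
Passing from P' to P for a function bounded by 1 + 1 / c costs another 2 (1 + 1 / c), in total 2 + 4
/ c. -/
lemma integral_armProb_mul_relProbError_le
    (hac : (P' : Measure (Obs 𝒳 𝒲)) ≪ (P : Measure (Obs 𝒳 𝒲)))
    (hfin : eLpNorm (fun o => sqrtDensity P P' o - 1) 2 (P : Measure (Obs 𝒳 𝒲)) ≠ ∞)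
    {c : ℝ} (hc : 0 < c) (a : Bool) :
    ∫⁻ o, ENNReal.ofReal (armProb P a (covar o)) * ‖relProbError P P' c a (covar o)‖ₑ
        ∂(P : Measure (Obs 𝒳 𝒲)) ≤
      ENNReal.ofReal (2 + 4 * c⁻¹) *
        eLpNorm (fun o => sqrtDensity P P' o - 1) 2 (P : Measure (Obs 𝒳 𝒲)) := by
  set u : 𝒲 × 𝒳 → ℝ := fun v => armProb P a v * |relProbError P P' c a v| with hu
  have hum : Measurable u := (measurable_armProb P a).mul (measurable_relProbError c a).abs
  have hu0 (v : 𝒲 × 𝒳) : 0 ≤ u v := mul_nonneg (armProb_nonneg P a v) (abs_nonneg _)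
  have huK (v : 𝒲 × 𝒳) : |u v| ≤ 1 + c⁻¹ := by
    rw [abs_of_nonneg (hu0 v)]
    exact (mul_le_of_le_one_left (abs_nonneg _) (armProb_le_one P a v)).trans
      (abs_relProbError_le hc a v)
  have h1 := abs_integral_sub_le hac (u := fun o => u (covar o)) (hum.comp measurable_covar)
    (fun o => huK _) hfin
  have h2 : ∫ o, u (covar o) ∂(P' : Measure (Obs 𝒳 𝒲)) ≤
      c⁻¹ * ∫ o, |armProb P a (covar o) - armProb P' a (covar o)| ∂(P' : Measure (Obs 𝒳 𝒲)) := by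
    rw [← integral_const_mul]
    refine integral_mono (integrable_bounded_covar P' hum huK) (Integrable.const_mul ?_ _)
      fun o => armProb_mul_abs_relProbError_le hc a _
    exact (integrable_bounded_covar P' (f := fun v => armProb P a v - armProb P' a v)
      ((measurable_armProb P a).sub (measurable_armProb P' a)) (abs_armProb_sub_le a)).abs
  have h3 := integral_abs_armProb_sub_le hac hfin a
  have hle : ∫ o, u (covar o) ∂(P : Measure (Obs 𝒳 𝒲)) ≤ (2 + 4 * c⁻¹) *
      (eLpNorm (fun o => sqrtDensity P P' o - 1) 2 (P : Measure (Obs 𝒳 𝒲))).toReal := by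
    have h4 := (abs_le.1 h1).1
    have h5 := mul_le_mul_of_nonneg_left h3 (inv_pos.2 hc).le
    linarith
  have h6 : ∫⁻ o, ENNReal.ofReal (armProb P a (covar o)) * ‖relProbError P P' c a (covar o)‖ₑ
      ∂(P : Measure (Obs 𝒳 𝒲)) = ENNReal.ofReal (∫ o, u (covar o) ∂(P : Measure (Obs 𝒳 𝒲))) := by
    rw [ofReal_integral_eq_lintegral_ofReal (integrable_bounded_covar P hum huK)
      (ae_of_all _ fun o => hu0 _)]
    refine lintegral_congr fun o => ?_
    rw [hu, ENNReal.ofReal_mul (armProb_nonneg P a _), ← Real.norm_eq_abs, ofReal_norm]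
  rw [h6]
  refine (ENNReal.ofReal_le_ofReal hle).trans_eq ?_
  rw [ENNReal.ofReal_mul (by positivity), ENNReal.ofReal_toReal hfin]

lemma tendsto_relProbError_mul {Pt : ℝ → ProbabilityMeasure (Obs 𝒳 𝒲)} {S : Obs 𝒳 𝒲 → ℝ}
    (h : IsQMDPath P Pt S) (hpos : Positivity P) {c : ℝ} (hc : 0 < c) (a : Bool) :
    Tendsto (fun ε => eLpNorm (fun o => relProbError P (Pt ε) c a (covar o) * S o) 2
      (P : Measure (Obs 𝒳 𝒲))) (𝓝[≠] 0) (𝓝 0) := by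
  refine tendsto_eLpNorm_mul_of_weighted
    (m := fun ε o => relProbError P (Pt ε) c a (covar o))
    (fun ε => (measurable_relProbError c a).comp measurable_covar)
    (fun ε o => abs_relProbError_le hc a _) ((measurable_armProb P a).comp measurable_covar)
    (hpos.armProb_pos a) ?_ h.score_memLp
  have hs := h.tendsto_sqrtDensity
  have hup := ENNReal.Tendsto.const_mul (a := ENNReal.ofReal (2 + 4 * c⁻¹)) hs
    (Or.inr (by finiteness))
  rw [mul_zero] at hup
  refine tendsto_of_tendsto_of_tendsto_of_le_of_le' tendsto_const_nhds hup
    (Eventually.of_forall fun _ => zero_le) ?_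
  filter_upwards [h.dominated.filter_mono nhdsWithin_le_nhds,
    ENNReal.tendsto_nhds_zero.1 hs 1 (by norm_num)] with ε hac h1
  exact integral_armProb_mul_relProbError_le hac (h1.trans_lt (by finiteness)).ne hc a

/-- Inverse probability weighting under P' with F the regression of P, after replacing the weight 1
/ π' by (1 + m) / π. -/
lemma integral_armMean_sub (hpos : Positivity P)
    (hY' : Integrable obsY (P' : Measure (Obs 𝒳 𝒲))) (hpos' : Positivity P')
    (hac : (P' : Measure (Obs 𝒳 𝒲)) ≪ (P : Measure (Obs 𝒳 𝒲))) {c : ℝ} (hc : 0 < c) {a : Bool}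
    (hlow : ∀ᵐ o ∂(P' : Measure (Obs 𝒳 𝒲)),
      c * armProb P a (covar o) ≤ armProb P' a (covar o))
    (hres : Integrable (armResidual P a) (P' : Measure (Obs 𝒳 𝒲))) :
    Integrable (fun o => armMean P' a (covar o) - armMean P a (covar o))
        (P' : Measure (Obs 𝒳 𝒲)) ∧
      ∫ o, (armMean P' a (covar o) - armMean P a (covar o)) ∂(P' : Measure (Obs 𝒳 𝒲)) =
        ∫ o, armResidual P a o ∂(P' : Measure (Obs 𝒳 𝒲)) +
          ∫ o, relProbError P P' c a (covar o) * armResidual P a o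
            ∂(P' : Measure (Obs 𝒳 𝒲)) := by
  have hm : Integrable (fun o => relProbError P P' c a (covar o) * armResidual P a o)
      (P' : Measure (Obs 𝒳 𝒲)) :=
    hres.bdd_mul ((measurable_relProbError c a).comp measurable_covar).aestronglyMeasurable
      (ae_of_all _ fun o => abs_relProbError_le hc a _)
  -- Where c π ≤ π' the maximum in the denominator of `relProbError` is π', so 1 + m = π / π'. The
  -- truncation only serves to bound m everywhere.
  have he : (fun o => armResidual P a o + relProbError P P' c a (covar o) * armResidual P a o)
      =ᵐ[(P' : Measure (Obs 𝒳 𝒲))] fun o => (armProb P' a (covar o))⁻¹ *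
        (armInd a o * (obsY o - armMean P a (covar o))) := by
    filter_upwards [hlow, hpos'.armProb_pos a, hac.ae_le (hpos.armProb_pos a)]
      with o h1 h2 h3
    rw [relProbError, max_eq_left h1, armResidual_eq]
    field_simp
    ring
  have h := integral_ipw hY' hpos' (measurable_armMean P a)
    ((hres.add hm).congr he)
  refine ⟨h.1, ?_⟩
  rw [h.2, ← integral_congr_ae he, integral_add hres hm]

lemma psi_expansion (hP : InModel P) (hP' : InModel P')
    (hac : (P' : Measure (Obs 𝒳 𝒲)) ≪ (P : Measure (Obs 𝒳 𝒲))) {c : ℝ} (hc : 0 < c)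
    (hlow : ∀ a, ∀ᵐ o ∂(P' : Measure (Obs 𝒳 𝒲)),
      c * armProb P a (covar o) ≤ armProb P' a (covar o))
    (hres : ∀ a, Integrable (armResidual P a) (P' : Measure (Obs 𝒳 𝒲)))
    (hcon : Integrable (fun o => contrast P (obsW o) (obsX o)) (P' : Measure (Obs 𝒳 𝒲))) :
    psi P' = ∫ o, armResidual P true o ∂(P' : Measure (Obs 𝒳 𝒲)) -
        ∫ o, armResidual P false o ∂(P' : Measure (Obs 𝒳 𝒲)) +
        ∫ o, contrast P (obsW o) (obsX o) ∂(P' : Measure (Obs 𝒳 𝒲)) +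
      (∫ o, relProbError P P' c true (covar o) * armResidual P true o
          ∂(P' : Measure (Obs 𝒳 𝒲)) -
        ∫ o, relProbError P P' c false (covar o) * armResidual P false o
          ∂(P' : Measure (Obs 𝒳 𝒲))) := by
  obtain ⟨i1, e1⟩ := integral_armMean_sub hP.positivity hP'.integrable_outcome
    hP'.positivity hac hc (hlow true) (hres true)
  obtain ⟨i0, e0⟩ := integral_armMean_sub hP.positivity hP'.integrable_outcome
    hP'.positivity hac hc (hlow false) (hres false)
  have : psi P' = ∫ o, ((armMean P' true (covar o) - armMean P true (covar o)) -
      (armMean P' false (covar o) - armMean P false (covar o)) +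
        contrast P (obsW o) (obsX o)) ∂(P' : Measure (Obs 𝒳 𝒲)) := by
    refine integral_congr_ae (ae_of_all _ fun o => ?_)
    simp only [contrast, armMean, covar]
    ring
  have i10 : Integrable (fun o => (armMean P' true (covar o) - armMean P true (covar o)) -
      (armMean P' false (covar o) - armMean P false (covar o))) (P' : Measure (Obs 𝒳 𝒲)) :=
    i1.sub i0
  rw [this, integral_add i10 hcon, integral_sub i1 i0, e1, e0]
  ring

lemma IsRegularSubmodel.hasDerivAt_psi {Pt : ℝ → ProbabilityMeasure (Obs 𝒳 𝒲)}
    {S : Obs 𝒳 𝒲 → ℝ} (hP : InModel P) (h : IsRegularSubmodel P Pt S) :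
    HasDerivAt (fun ε => psi (Pt ε)) (∫ o, aipw P o * S o ∂(P : Measure (Obs 𝒳 𝒲))) 0 := by
  have hq := h.toIsQMDPath
  obtain ⟨c, hc, hlow⟩ := h.positivity_locally
  obtain ⟨C, hC, hmom⟩ := h.moments_locally
  have hmr (a : Bool) : ∀ᶠ ε in 𝓝 (0 : ℝ),
      eLpNorm (armResidual P a) 2 (Pt ε : Measure (Obs 𝒳 𝒲)) ≤ C := by
    cases a
    · rw [armResidual_false]; exact hmom.mono fun ε h => h.2.1
    · rw [armResidual_true]; exact hmom.mono fun ε h => h.1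
  have hmc : ∀ᶠ ε in 𝓝 (0 : ℝ), eLpNorm (fun o => contrast P (obsW o) (obsX o)) 2
      (Pt ε : Measure (Obs 𝒳 𝒲)) ≤ C := hmom.mono fun ε h => h.2.2
  have hcm : Measurable (fun o : Obs 𝒳 𝒲 => contrast P (obsW o) (obsX o)) := measurable_contrast
  have dres (a : Bool) := hq.hasDerivAt_integral (measurable_armResidual P a) hC (hmr a)
  have dcon := hq.hasDerivAt_integral hcm hC hmc
  -- The local moment bound at ε = 0 itself gives square integrability under P.
  have hLr (a : Bool) : MemLp (armResidual P a) 2 (P : Measure (Obs 𝒳 𝒲)) := by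
    have := (hmr a).self_of_nhds
    rw [hq.through] at this
    exact ⟨(measurable_armResidual P a).aestronglyMeasurable, this.trans_lt hC.lt_top⟩
  have hLc : MemLp (fun o => contrast P (obsW o) (obsX o)) 2 (P : Measure (Obs 𝒳 𝒲)) := by
    have := hmc.self_of_nhds
    rw [hq.through] at this
    exact ⟨hcm.aestronglyMeasurable, this.trans_lt hC.lt_top⟩
  have drem (a : Bool) := hq.hasDerivAt_integral_mul_zero (measurable_armResidual P a) hC (hmr a)
    (m := fun ε o => relProbError P (Pt ε) c a (covar o))
    (fun ε => (measurable_relProbError c a).comp measurable_covar)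
    (fun ε o => abs_relProbError_le hc a _) (tendsto_relProbError_mul hq hP.positivity hc a)
    (fun ε => integral_mul_armResidual hP.integrable_outcome (measurable_relProbError c a)
      (((hLr a).integrable (by norm_num)).bdd_mul
        ((measurable_relProbError c a).comp measurable_covar).aestronglyMeasurable
        (ae_of_all _ fun o => abs_relProbError_le hc a _)))
  have hd := (((dres true).sub (dres false)).add dcon).add ((drem true).sub (drem false))
  have hval : ∫ o, aipw P o * S o ∂(P : Measure (Obs 𝒳 𝒲)) =
      ∫ o, armResidual P true o * S o ∂(P : Measure (Obs 𝒳 𝒲)) -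
        ∫ o, armResidual P false o * S o ∂(P : Measure (Obs 𝒳 𝒲)) +
        ∫ o, contrast P (obsW o) (obsX o) * S o ∂(P : Measure (Obs 𝒳 𝒲)) + (0 - 0) := by
    have hS := hq.score_memLp
    have i1 : Integrable (fun o => armResidual P true o * S o) (P : Measure (Obs 𝒳 𝒲)) :=
      (hLr true).integrable_mul hS
    have i0 : Integrable (fun o => armResidual P false o * S o) (P : Measure (Obs 𝒳 𝒲)) :=
      (hLr false).integrable_mul hS
    have ic : Integrable (fun o => contrast P (obsW o) (obsX o) * S o)
        (P : Measure (Obs 𝒳 𝒲)) := hLc.integrable_mul hS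
    have iψ : Integrable (fun o => psi P * S o) (P : Measure (Obs 𝒳 𝒲)) :=
      (hS.integrable (by norm_num)).const_mul _
    have e : (fun o => aipw P o * S o) = fun o => armResidual P true o * S o -
        armResidual P false o * S o + contrast P (obsW o) (obsX o) * S o - psi P * S o := by
      funext o
      rw [aipw, armResidual_true, armResidual_false]
      ring
    have i10 : Integrable (fun o => armResidual P true o * S o - armResidual P false o * S o)
        (P : Measure (Obs 𝒳 𝒲)) := i1.sub i0
    have i10c : Integrable (fun o => armResidual P true o * S o - armResidual P false o * S o +
        contrast P (obsW o) (obsX o) * S o) (P : Measure (Obs 𝒳 𝒲)) := i10.add ic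
    -- The centring constant ψ(P) drops out because scores have mean zero.
    rw [e, integral_sub i10c iψ, integral_add i10 ic,
      integral_sub i1 i0, integral_const_mul, hq.integral_score]
    ring
  rw [hval]
  refine hd.congr_of_eventuallyEq ?_
  filter_upwards [h.inModel, hq.dominated, hlow, hmr true, hmr false, hmc]
    with ε hM hac hl h1 h0 hcε
  refine psi_expansion hP hM hac hc (fun a => ?_) (fun a => ?_)
    (integrable_of_eLpNorm_two_le hcm hC hcε)
  · cases a
    · exact hl.mono fun o ho => ho.2
    · exact hl.mono fun o ho => ho.1
  · cases a
    · exact integrable_of_eLpNorm_two_le (measurable_armResidual P _) hC h0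
    · exact integrable_of_eLpNorm_two_le (measurable_armResidual P _) hC h1

end Derivative


/-! ### Stability of the model under comparable changes of law -/

section Comparable

variable {𝒳 𝒲 : Type*} [MeasurableSpace 𝒳] [MeasurableSpace 𝒲]
  {P P' : ProbabilityMeasure (Obs 𝒳 𝒲)}

lemma integral_le_two_mul {Ω : Type*} [MeasurableSpace Ω] {μ ν : Measure Ω}
    (h : μ ≤ (2 : ℝ≥0∞) • ν) {f : Ω → ℝ} (hf : ∀ o, 0 ≤ f o) (hi : Integrable f ν) :
    ∫ o, f o ∂μ ≤ 2 * ∫ o, f o ∂ν := by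
  refine (integral_mono_measure h (ae_of_all _ hf) (hi.smul_measure (by simp))).trans_eq ?_
  rw [integral_smul_measure]; simp

/-- Treatment probabilities of mutually comparable laws are comparable. -/
lemma ae_armProb_le (h1 : (P' : Measure (Obs 𝒳 𝒲)) ≤ (2 : ℝ≥0∞) • (P : Measure (Obs 𝒳 𝒲)))
    (h2 : (P : Measure (Obs 𝒳 𝒲)) ≤ (2 : ℝ≥0∞) • (P' : Measure (Obs 𝒳 𝒲))) (a : Bool) :
    ∀ᵐ o ∂(P' : Measure (Obs 𝒳 𝒲)), 1 / 4 * armProb P a (covar o) ≤ armProb P' a (covar o) := by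
  -- With f the indicator of the bad set {4 π' < π}, E'[f π] ≤ 2 E[f π] = 2 E[f 1{A = a}] ≤ 4 E'[f
  -- 1{A = a}] = 4 E'[f π']. As f (π - 4 π') is nonnegative, it vanishes almost surely. Each
  -- comparison costs a factor 2, whence the 4.
  set f : 𝒲 × 𝒳 → ℝ := fun v => if 4 * armProb P' a v < armProb P a v then 1 else 0 with hf
  have hfm : Measurable f := Measurable.ite
    (measurableSet_lt ((measurable_armProb P' a).const_mul 4) (measurable_armProb P a))
    measurable_const measurable_const
  have hf0 (v : 𝒲 × 𝒳) : 0 ≤ f v := by simp only [hf]; split_ifs <;> norm_num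
  have hf1 (v : 𝒲 × 𝒳) : |f v| ≤ 1 := by simp only [hf]; split_ifs <;> simp
  have hind (Q : ProbabilityMeasure (Obs 𝒳 𝒲)) :
      Integrable (fun o => f (covar o) * armInd a o) (Q : Measure (Obs 𝒳 𝒲)) :=
    (integrable_armInd a).bdd_mul (c := 1) (hfm.comp measurable_covar).aestronglyMeasurable
      (ae_of_all _ fun o => hf1 _)
  have hprob (Q R : ProbabilityMeasure (Obs 𝒳 𝒲)) :
      Integrable (fun o => f (covar o) * armProb Q a (covar o)) (R : Measure (Obs 𝒳 𝒲)) :=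
    integrable_bounded_covar R (f := fun v => f v * armProb Q a v)
      (hfm.mul (measurable_armProb Q a)) (K := 1) fun v => by
        rw [abs_mul, abs_of_nonneg (armProb_nonneg Q a v)]
        exact mul_le_one₀ (hf1 v) (armProb_nonneg Q a v) (armProb_le_one Q a v)
  have e1 := integral_le_two_mul h1 (f := fun o => f (covar o) * armProb P a (covar o))
    (fun o => mul_nonneg (hf0 _) (armProb_nonneg P a _)) (hprob P P)
  have e2 := integral_le_two_mul h2 (f := fun o => f (covar o) * armInd a o)
    (fun o => mul_nonneg (hf0 _) (armInd_nonneg a o)) (hind P')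
  have e3 := (integrable_mul_armProb hfm (hind P)).2
  have e4 := (integrable_mul_armProb hfm (hind P')).2
  have hnn (o : Obs 𝒳 𝒲) :
      0 ≤ f (covar o) * armProb P a (covar o) - 4 * (f (covar o) * armProb P' a (covar o)) := by
    simp only [hf]
    split_ifs with h
    · linarith
    · simp
  have hI : Integrable (fun o => f (covar o) * armProb P a (covar o) -
      4 * (f (covar o) * armProb P' a (covar o))) (P' : Measure (Obs 𝒳 𝒲)) :=
    (hprob P P').sub ((hprob P' P').const_mul 4)
  have hz : ∫ o, (f (covar o) * armProb P a (covar o) -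
      4 * (f (covar o) * armProb P' a (covar o))) ∂(P' : Measure (Obs 𝒳 𝒲)) = 0 := by
    refine le_antisymm ?_ (integral_nonneg hnn)
    rw [integral_sub (hprob P P') ((hprob P' P').const_mul 4), integral_const_mul]
    linarith
  rw [integral_eq_zero_iff_of_nonneg hnn hI] at hz
  filter_upwards [hz] with o ho
  by_contra hlt
  have hlt' : 4 * armProb P' a (covar o) < armProb P a (covar o) := by linarith [not_le.1 hlt]
  have hfo : f (covar o) = 1 := if_pos hlt'
  simp only [hfo, Pi.zero_apply, one_mul] at ho
  linarith

/-- The delicate point is integrability of the contrast of P': inverse probability weighting gives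
integrability of the difference of the two regressions in each arm, and the contrast of P remains
integrable under P'. -/
lemma inModel_of_comparable (hP : InModel P)
    (hres : ∀ a, Integrable (armResidual P a) (P : Measure (Obs 𝒳 𝒲)))
    (h1 : (P' : Measure (Obs 𝒳 𝒲)) ≤ (2 : ℝ≥0∞) • (P : Measure (Obs 𝒳 𝒲)))
    (h2 : (P : Measure (Obs 𝒳 𝒲)) ≤ (2 : ℝ≥0∞) • (P' : Measure (Obs 𝒳 𝒲))) :
    InModel P' := by
  have hac : (P' : Measure (Obs 𝒳 𝒲)) ≪ (P : Measure (Obs 𝒳 𝒲)) :=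
    Measure.absolutelyContinuous_of_le_smul h1
  have hpos : Positivity P' := by
    filter_upwards [ae_armProb_le h1 h2 true, ae_armProb_le h1 h2 false,
      hac.ae_le (hP.positivity.armProb_pos true), hac.ae_le (hP.positivity.armProb_pos false)]
      with o a1 a0 b1 b0
    have c1 : 0 < armProb P' true (covar o) := by linarith
    have c0 : 0 < armProb P' false (covar o) := by linarith
    exact ⟨by simpa [armProb, covar] using c1, by simpa [armProb, covar] using c0⟩
  have hY := hP.integrable_outcome.of_measure_le_smul (by simp) h1
  have hd (a : Bool) := (integral_armMean_sub hP.positivity hY hpos hac (c := 1 / 4)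
    (by norm_num) (ae_armProb_le h1 h2 a) ((hres a).of_measure_le_smul (by simp) h1)).1
  refine ⟨hpos, hY, ?_⟩
  refine (((hd true).sub (hd false)).add
    (hP.integrable_contrast.of_measure_le_smul (by simp) h1)).congr (ae_of_all _ fun o => ?_)
  simp only [Pi.add_apply, Pi.sub_apply, contrast, armMean, covar]
  ring

end Comparable

/-! ### Linear tilts of a law and their quadratic mean differentiability -/

section Tilt

lemma tilt_density_mem {Ω : Type*} {S : Ω → ℝ} (hS1 : ∀ o, |S o| ≤ 1) {ε : ℝ} (hε : |ε| ≤ 1 / 2) (o : Ω) :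
    1 / 2 ≤ 1 + ε * S o ∧ 1 + ε * S o ≤ 2 := by
  have h : |ε * S o| ≤ 1 / 2 * 1 := by
    rw [abs_mul]
    exact mul_le_mul hε (hS1 o) (abs_nonneg _) (by norm_num)
  have := abs_le.1 h
  constructor <;> linarith

variable {Ω : Type*} [MeasurableSpace Ω]

/-- A measure of total mass one, as a bundled law. -/
def lawOf (μ : Measure Ω) (h : IsProbabilityMeasure μ) : ProbabilityMeasure Ω := ⟨μ, h⟩

open Classical in
/-- The law with density `1 + ε S` with respect to `P`, when this is a probability density. -/
noncomputable def tilt (P : ProbabilityMeasure Ω) (S : Ω → ℝ) (ε : ℝ) : ProbabilityMeasure Ω :=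
  if h : IsProbabilityMeasure
      ((P : Measure Ω).withDensity fun o => ENNReal.ofReal (1 + ε * S o)) then lawOf _ h else P

variable {P : ProbabilityMeasure Ω} {S : Ω → ℝ}

lemma coe_tilt (hS : Measurable S) (hS1 : ∀ o, |S o| ≤ 1)
    (hS0 : ∫ o, S o ∂(P : Measure Ω) = 0) {ε : ℝ} (hε : |ε| ≤ 1 / 2) :
    (tilt P S ε : Measure Ω) =
      (P : Measure Ω).withDensity fun o => ENNReal.ofReal (1 + ε * S o) := by
  have hi : Integrable S (P : Measure Ω) :=
    Integrable.of_bound hS.aestronglyMeasurable 1 (ae_of_all _ hS1)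
  have hp : IsProbabilityMeasure
      ((P : Measure Ω).withDensity fun o => ENNReal.ofReal (1 + ε * S o)) := by
    have hd : Integrable (fun o => 1 + ε * S o) (P : Measure Ω) :=
      (integrable_const 1).add (hi.const_mul ε)
    refine ⟨?_⟩
    rw [withDensity_apply _ MeasurableSet.univ, Measure.restrict_univ,
      ← ofReal_integral_eq_lintegral_ofReal hd (ae_of_all _ fun o => by
        have := (tilt_density_mem hS1 hε o).1
        simp only [Pi.zero_apply]; linarith),
      integral_add (integrable_const 1) (hi.const_mul ε), integral_const_mul, hS0]
    simp
  rw [tilt, dif_pos hp]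
  rfl

lemma tilt_zero (hS : Measurable S) (hS1 : ∀ o, |S o| ≤ 1)
    (hS0 : ∫ o, S o ∂(P : Measure Ω) = 0) : tilt P S 0 = P := by
  apply Subtype.ext
  refine (coe_tilt hS hS1 hS0 (by norm_num)).trans ?_
  simp

lemma tilt_le (hS : Measurable S) (hS1 : ∀ o, |S o| ≤ 1)
    (hS0 : ∫ o, S o ∂(P : Measure Ω) = 0) {ε : ℝ} (hε : |ε| ≤ 1 / 2) :
    (tilt P S ε : Measure Ω) ≤ (2 : ℝ≥0∞) • (P : Measure Ω) := by
  rw [coe_tilt hS hS1 hS0 hε, ← withDensity_const]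
  refine withDensity_mono (ae_of_all _ fun o => ?_)
  rw [← ENNReal.ofReal_ofNat]
  exact ENNReal.ofReal_le_ofReal (tilt_density_mem hS1 hε o).2

lemma le_tilt (hS : Measurable S) (hS1 : ∀ o, |S o| ≤ 1)
    (hS0 : ∫ o, S o ∂(P : Measure Ω) = 0) {ε : ℝ} (hε : |ε| ≤ 1 / 2) :
    (P : Measure Ω) ≤ (2 : ℝ≥0∞) • (tilt P S ε : Measure Ω) := by
  rw [coe_tilt hS hS1 hS0 hε, ← withDensity_smul _ (by fun_prop)]
  conv_lhs => rw [← withDensity_one (μ := (P : Measure Ω))]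
  refine withDensity_mono (ae_of_all _ fun o => ?_)
  have := (tilt_density_mem hS1 hε o).1
  simp only [Pi.one_apply, Pi.smul_apply, smul_eq_mul]
  rw [← ENNReal.ofReal_ofNat, ← ENNReal.ofReal_mul (by norm_num), ENNReal.one_le_ofReal]
  linarith

/-- The error is exactly -(√(1 + t) - 1)² / 2, and |√(1 + t) - 1| ≤ |t| because t = (√(1 + t) -
1)(√(1 + t) + 1). -/
lemma abs_sqrt_one_add_sub_le {t : ℝ} (ht : -1 ≤ t) : |√(1 + t) - 1 - t / 2| ≤ t ^ 2 / 2 := by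
  have h0 := Real.sqrt_nonneg (1 + t)
  have h1 := Real.mul_self_sqrt (show 0 ≤ 1 + t by linarith)
  have h2 : √(1 + t) - 1 - t / 2 = -(√(1 + t) - 1) ^ 2 / 2 := by
    have : t = √(1 + t) * √(1 + t) - 1 := by linarith
    nlinarith
  have h3 : (√(1 + t) - 1) ^ 2 ≤ t ^ 2 := by
    have : t = (√(1 + t) - 1) * (√(1 + t) + 1) := by linarith
    nth_rw 2 [this]
    rw [mul_pow]
    exact le_mul_of_one_le_right (sq_nonneg _) (by nlinarith)
  rw [h2, abs_of_nonpos (by nlinarith [sq_nonneg (√(1 + t) - 1)])]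
  linarith

lemma abs_sqrt_quotient_le {ε s : ℝ} (hε0 : ε ≠ 0) (hε : |ε| ≤ 1 / 2) (hs : |s| ≤ 1) :
    |(√(1 + ε * s) - 1) / ε - s / 2| ≤ |ε| := by
  have h : |ε * s| ≤ 1 / 2 * 1 := by
    rw [abs_mul]
    exact mul_le_mul hε hs (abs_nonneg _) (by norm_num)
  have h1 := abs_sqrt_one_add_sub_le (t := ε * s) (by linarith [(abs_le.1 h).1])
  have e : (√(1 + ε * s) - 1) / ε - s / 2 = (√(1 + ε * s) - 1 - ε * s / 2) / ε := by
    field_simp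
  have hp : 0 < |ε| := abs_pos.2 hε0
  rw [e, abs_div, div_le_iff₀ hp]
  refine h1.trans ?_
  rw [mul_pow, ← sq_abs ε, ← sq_abs s]
  have : |s| ^ 2 ≤ 1 := pow_le_one₀ (abs_nonneg _) hs
  nlinarith [sq_nonneg |ε|]

lemma eventually_abs_le_half : ∀ᶠ ε in 𝓝 (0 : ℝ), |ε| ≤ 1 / 2 := by
  filter_upwards [Metric.ball_mem_nhds (0 : ℝ) (by norm_num : (0 : ℝ) < 1 / 2)] with ε hε
  rw [Metric.mem_ball, dist_zero_right, Real.norm_eq_abs] at hε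
  exact hε.le

/-- The remainder is bounded pointwise by |ε|. The score is allowed to be any version s of S because
the tangent space is spanned by classes in L₂, whose representatives are only determined almost
everywhere. -/
lemma isQMDPath_tilt (hS : Measurable S) (hS1 : ∀ o, |S o| ≤ 1)
    (hS0 : ∫ o, S o ∂(P : Measure Ω) = 0) {s : Ω → ℝ} (hs : s =ᵐ[(P : Measure Ω)] S) :
    IsQMDPath P (tilt P S) s where
  through := tilt_zero hS hS1 hS0
  dominated := by
    filter_upwards [eventually_abs_le_half] with ε hε
    exact Measure.absolutelyContinuous_of_le_smul (tilt_le hS hS1 hS0 hε)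
  score_memLp := MemLp.ae_eq hs.symm
    (MemLp.of_bound hS.aestronglyMeasurable 1 (ae_of_all _ hS1))
  qmd := by
    have hup : Tendsto (fun ε : ℝ => ENNReal.ofReal |ε|) (𝓝[≠] 0) (𝓝 0) := by
      have : Tendsto (fun ε : ℝ => ENNReal.ofReal |ε|) (𝓝 0) (𝓝 (ENNReal.ofReal |0|)) :=
        (ENNReal.continuous_ofReal.comp continuous_abs).tendsto 0
      rw [abs_zero, ENNReal.ofReal_zero] at this
      exact this.mono_left nhdsWithin_le_nhds
    refine tendsto_of_tendsto_of_tendsto_of_le_of_le' tendsto_const_nhds hup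
      (Eventually.of_forall fun _ => zero_le) ?_
    filter_upwards [self_mem_nhdsWithin, eventually_abs_le_half.filter_mono nhdsWithin_le_nhds]
      with ε hε0 hε
    have hrn : (tilt P S ε : Measure Ω).rnDeriv (P : Measure Ω) =ᵐ[(P : Measure Ω)]
        fun o => ENNReal.ofReal (1 + ε * S o) := by
      rw [coe_tilt hS hS1 hS0 hε]
      exact Measure.rnDeriv_withDensity _ (by fun_prop)
    refine (eLpNorm_le_of_ae_bound (C := |ε|) ?_).trans (by simp)
    filter_upwards [hrn, hs] with o ho hso
    rw [ho, hso, ENNReal.toReal_ofReal (by linarith [(tilt_density_mem hS1 hε o).1])]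
    exact abs_sqrt_quotient_le hε0 hε (hS1 o)

end Tilt

/-! ### The tangent space and uniqueness of the influence function -/

section Tangent

variable {𝒳 𝒲 : Type*} [MeasurableSpace 𝒳] [MeasurableSpace 𝒲]
  {P : ProbabilityMeasure (Obs 𝒳 𝒲)}

/-- Every mean zero function bounded by one is the score of a regular submodel. -/
lemma isRegularSubmodel_tilt (hP : InModel P)
    (hvar : MemLp (aipw P) 2 (P : Measure (Obs 𝒳 𝒲))) {S s : Obs 𝒳 𝒲 → ℝ} (hS : Measurable S)
    (hS1 : ∀ o, |S o| ≤ 1) (hS0 : ∫ o, S o ∂(P : Measure (Obs 𝒳 𝒲)) = 0)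
    (hs : s =ᵐ[(P : Measure (Obs 𝒳 𝒲))] S) : IsRegularSubmodel P (tilt P S) s where
  toIsQMDPath := isQMDPath_tilt hS hS1 hS0 hs
  inModel := by
    filter_upwards [eventually_abs_le_half] with ε hε
    exact inModel_of_comparable hP
      (fun a => ((memLp_parts hP hvar).2 a).integrable (by norm_num))
      (tilt_le hS hS1 hS0 hε) (le_tilt hS hS1 hS0 hε)
  positivity_locally := by
    refine ⟨1 / 4, by norm_num, ?_⟩
    filter_upwards [eventually_abs_le_half] with ε hε
    filter_upwards [ae_armProb_le (tilt_le hS hS1 hS0 hε) (le_tilt hS hS1 hS0 hε) true,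
      ae_armProb_le (tilt_le hS hS1 hS0 hε) (le_tilt hS hS1 hS0 hε) false] with o h1 h0
    exact ⟨h1, h0⟩
  moments_locally := by
    obtain ⟨hc, hr⟩ := memLp_parts hP hvar
    have h1 := (hr true).smul_measure (c := (2 : ℝ≥0∞)) (by simp)
    have h0 := (hr false).smul_measure (c := (2 : ℝ≥0∞)) (by simp)
    have hc' := hc.smul_measure (c := (2 : ℝ≥0∞)) (by simp)
    rw [armResidual_true] at h1
    rw [armResidual_false] at h0
    refine ⟨_, (ENNReal.add_lt_top.2 ⟨ENNReal.add_lt_top.2 ⟨h1.2, h0.2⟩, hc'.2⟩).ne, ?_⟩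
    filter_upwards [eventually_abs_le_half] with ε hε
    have hle := tilt_le hS hS1 hS0 hε
    refine ⟨(eLpNorm_mono_measure _ hle).trans ?_, (eLpNorm_mono_measure _ hle).trans ?_,
      (eLpNorm_mono_measure _ hle).trans le_add_self⟩
    · exact le_self_add.trans le_self_add
    · exact le_add_self.trans le_self_add

/-- Functions orthogonal to the scores of all regular submodels are constant. -/
lemma ae_eq_const_of_orthogonal (hP : InModel P)
    (hvar : MemLp (aipw P) 2 (P : Measure (Obs 𝒳 𝒲))) {v : Obs 𝒳 𝒲 → ℝ}
    (hv : MemLp v 2 (P : Measure (Obs 𝒳 𝒲)))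
    (h : ∀ (Pt : ℝ → ProbabilityMeasure (Obs 𝒳 𝒲)) (S : Lp ℝ 2 (P : Measure (Obs 𝒳 𝒲))),
      IsRegularSubmodel P Pt S → ∫ o, v o * S o ∂(P : Measure (Obs 𝒳 𝒲)) = 0) :
    v =ᵐ[(P : Measure (Obs 𝒳 𝒲))] fun _ => ∫ o, v o ∂(P : Measure (Obs 𝒳 𝒲)) := by
  have hvI : Integrable v (P : Measure (Obs 𝒳 𝒲)) := hv.integrable (by norm_num)
  refine hvI.ae_eq_of_forall_setIntegral_eq v _ (integrable_const _) fun B hB _ => ?_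
  -- Orthogonality of v to the centred indicator of B says that the integral of v over B is P(B)
  -- E[v].
  set S : Obs 𝒳 𝒲 → ℝ := fun o => B.indicator (fun _ => 1) o -
    (P : Measure (Obs 𝒳 𝒲)).real B with hSdef
  have hSm : Measurable S := (measurable_const.indicator hB).sub_const _
  have hS1 (o : Obs 𝒳 𝒲) : |S o| ≤ 1 := by
    have h0 : 0 ≤ (P : Measure (Obs 𝒳 𝒲)).real B := measureReal_nonneg
    have h1 : (P : Measure (Obs 𝒳 𝒲)).real B ≤ 1 := measureReal_le_one
    simp only [hSdef, Set.indicator]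
    rw [abs_le]
    split_ifs <;> constructor <;> linarith
  have hS0 : ∫ o, S o ∂(P : Measure (Obs 𝒳 𝒲)) = 0 := by
    simp only [hSdef]
    rw [integral_sub ((integrable_const _).indicator hB) (integrable_const _),
      integral_indicator_const _ hB]
    simp
  have hSL : MemLp S 2 (P : Measure (Obs 𝒳 𝒲)) :=
    MemLp.of_bound hSm.aestronglyMeasurable 1 (ae_of_all _ hS1)
  have h0 := h (tilt P S) (hSL.toLp S)
    (isRegularSubmodel_tilt hP hvar hSm hS1 hS0 hSL.coeFn_toLp)
  have h1 : ∫ o, v o * S o ∂(P : Measure (Obs 𝒳 𝒲)) = 0 := by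
    rw [← h0]
    refine integral_congr_ae ?_
    filter_upwards [hSL.coeFn_toLp] with o ho
    rw [ho]
  have h2 : (fun o => v o * S o) = fun o => B.indicator v o -
      (P : Measure (Obs 𝒳 𝒲)).real B * v o := by
    funext o
    simp only [hSdef, Set.indicator]
    split_ifs <;> ring
  rw [h2, integral_sub (hvI.indicator hB) (hvI.const_mul _), integral_const_mul,
    integral_indicator hB] at h1
  rw [setIntegral_const, smul_eq_mul]
  linarith

lemma integral_aipw (hP : InModel P) (hvar : MemLp (aipw P) 2 (P : Measure (Obs 𝒳 𝒲))) :
    ∫ o, aipw P o ∂(P : Measure (Obs 𝒳 𝒲)) = 0 := by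
  have hr (a : Bool) : Integrable (armResidual P a) (P : Measure (Obs 𝒳 𝒲)) :=
    ((memLp_parts hP hvar).2 a).integrable (by norm_num)
  have hz (a : Bool) : ∫ o, armResidual P a o ∂(P : Measure (Obs 𝒳 𝒲)) = 0 := by
    simpa using integral_mul_armResidual (k := fun _ => 1) hP.integrable_outcome
      measurable_const (a := a) (by simpa using hr a)
  have e : aipw P = fun o => armResidual P true o - armResidual P false o +
      contrast P (obsW o) (obsX o) - psi P := by
    funext o
    rw [aipw, armResidual_true, armResidual_false]
  have i10 : Integrable (fun o => armResidual P true o - armResidual P false o)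
      (P : Measure (Obs 𝒳 𝒲)) := (hr true).sub (hr false)
  have i10c : Integrable (fun o => armResidual P true o - armResidual P false o +
      contrast P (obsW o) (obsX o)) (P : Measure (Obs 𝒳 𝒲)) := i10.add hP.integrable_contrast
  rw [e, integral_sub i10c (integrable_const _), integral_add i10 hP.integrable_contrast,
    integral_sub (hr true) (hr false), hz, hz]
  simp [psi]

lemma inner_eq_integral (f g : Lp ℝ 2 (P : Measure (Obs 𝒳 𝒲))) :
    inner ℝ f g = ∫ o, f o * g o ∂(P : Measure (Obs 𝒳 𝒲)) := by
  rw [L2.inner_def]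
  refine integral_congr_ae (ae_of_all _ fun o => ?_)
  simp [mul_comm]

/-- The tangent space of the model contains all square integrable functions with mean zero. -/
lemma toLp_mem_tangentSpace (hP : InModel P)
    (hvar : MemLp (aipw P) 2 (P : Measure (Obs 𝒳 𝒲))) {f : Obs 𝒳 𝒲 → ℝ}
    (hf : MemLp f 2 (P : Measure (Obs 𝒳 𝒲))) (hf0 : ∫ o, f o ∂(P : Measure (Obs 𝒳 𝒲)) = 0) :
    hf.toLp f ∈ tangentSpace P (IsRegularSubmodel P) := by
  -- The closed span is the double orthogonal complement, so it suffices to pair f with elements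
  -- orthogonal to all scores; these are constant and f has mean zero.
  rw [tangentSpace, ← Submodule.orthogonal_orthogonal_eq_closure, Submodule.mem_orthogonal]
  intro v hv
  rw [Submodule.mem_orthogonal'] at hv
  have hc := ae_eq_const_of_orthogonal hP hvar (Lp.memLp v) fun Pt S hS => by
    rw [← inner_eq_integral]
    exact hv S (Submodule.subset_span ⟨Pt, hS⟩)
  rw [inner_eq_integral]
  have : ∫ o, v o * hf.toLp f o ∂(P : Measure (Obs 𝒳 𝒲)) =
      ∫ o, (∫ o, v o ∂(P : Measure (Obs 𝒳 𝒲))) * f o ∂(P : Measure (Obs 𝒳 𝒲)) := by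
    refine integral_congr_ae ?_
    filter_upwards [hc, hf.coeFn_toLp] with o h1 h2
    rw [← h1, h2]
  rw [this, integral_const_mul, hf0, mul_zero]

/-- Any two influence functions along the regular submodels coincide almost surely. -/
lemma IsInfluenceFunction.ae_eq (hP : InModel P)
    (hvar : MemLp (aipw P) 2 (P : Measure (Obs 𝒳 𝒲)))
    {θ : ProbabilityMeasure (Obs 𝒳 𝒲) → ℝ} {φ χ : Obs 𝒳 𝒲 → ℝ}
    (hφ : IsInfluenceFunction P (IsRegularSubmodel P) θ φ)
    (hχ : IsInfluenceFunction P (IsRegularSubmodel P) θ χ) :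
    φ =ᵐ[(P : Measure (Obs 𝒳 𝒲))] χ := by
  have hc := ae_eq_const_of_orthogonal hP hvar (hφ.memLp.sub hχ.memLp) fun Pt S hS => by
    have h := (hφ.hasDerivAt Pt S hS).unique (hχ.hasDerivAt Pt S hS)
    have i1 : Integrable (fun o => φ o * S o) (P : Measure (Obs 𝒳 𝒲)) :=
      hφ.memLp.integrable_mul (Lp.memLp S)
    have i2 : Integrable (fun o => χ o * S o) (P : Measure (Obs 𝒳 𝒲)) :=
      hχ.memLp.integrable_mul (Lp.memLp S)
    simp only [Pi.sub_apply, sub_mul]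
    rw [integral_sub i1 i2, h, sub_self]
  have h0 : ∫ o, (φ - χ) o ∂(P : Measure (Obs 𝒳 𝒲)) = 0 := by
    simp only [Pi.sub_apply]
    rw [integral_sub (hφ.memLp.integrable (by norm_num)) (hχ.memLp.integrable (by norm_num)),
      hφ.mean_zero, hχ.mean_zero, sub_self]
  rw [h0] at hc
  filter_upwards [hc] with o ho
  exact sub_eq_zero.1 ho

end Tangent

end DirectEffect

theorem mainTheorem6 {𝒳 𝒲 : Type*} [MeasurableSpace 𝒳] [MeasurableSpace 𝒲]
    (P : ProbabilityMeasure (DirectEffect.Obs 𝒳 𝒲))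
    (hP : DirectEffect.InModel P)
    (hvar : MemLp (DirectEffect.aipw P) 2 (P : Measure (DirectEffect.Obs 𝒳 𝒲))) :
    DirectEffect.IsEfficientInfluenceFunction P (DirectEffect.IsRegularSubmodel P)
        DirectEffect.psi (DirectEffect.aipw P) ∧
      ∀ φ : DirectEffect.Obs 𝒳 𝒲 → ℝ,
        DirectEffect.IsEfficientInfluenceFunction P (DirectEffect.IsRegularSubmodel P)
          DirectEffect.psi φ →
        φ =ᵐ[(P : Measure (DirectEffect.Obs 𝒳 𝒲))] DirectEffect.aipw P := by
  have hmean := DirectEffect.integral_aipw hP hvar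
  have hIF : DirectEffect.IsInfluenceFunction P (DirectEffect.IsRegularSubmodel P)
      DirectEffect.psi (DirectEffect.aipw P) :=
    ⟨hvar, hmean, fun Pt S h => h.hasDerivAt_psi hP⟩
  exact ⟨⟨hIF, DirectEffect.toLp_mem_tangentSpace hP hvar hvar hmean⟩,
    fun φ hφ => hφ.toIsInfluenceFunction.ae_eq hP hvar hIF⟩
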